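/- Let $n\ge 0$. An operator $A$ on $m$ qubits is called rotationally invariant (symmetric) if $[A,U^{\otimes m}]=0$ for every single-qubit unitary $U$, and $k$-local if it acts non-trivially on at most $k$ qubits. Let $\mathcal V^{(m)}$ be the group of symmetric unitaries on $m$ qubits, and $\mathcal V^{(m)}_k$ the group generated by the $k$-local symmetric unitaries on $m$ qubits. Let $J^2=J_x^2+J_y^2+J_z^2$ with $J_v=\frac12\sum_i\sigma^{(v)}_i$, let $\mathcal H_j$ be the eigenspace of $J^2$ with eigenvalue $j(j+1)$, where $j=\frac m2,\frac m2-1,\dots,j_{\min}\in\{0,\frac12\}$, and let $\Pi_j$ be the orthogonal projection onto $\mathcal H_j$. With $R_{rs}=\frac12\sum_{v}\sigma^{(v)}_r\sigma^{(v)}_s$ put, for even $l\ge 0$, $$C_l=\frac1{(l/2)!}\sum_{i_1,\dots,i_l\ \mathrm{distinct}}R_{i_1i_2}\cdots R_{i_{l-1}i_l},\qquad C_0=\mathbb I,\qquad c_l(j)=\frac{\operatorname{Tr}(C_l\Pi_j)}{\operatorname{Tr}(\Pi_j)}$$ (so $C_l=0$ for $l>m$). The $l$-body phase of a symmetric unitary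 $V=\bigoplus_jV_j$ on $m$ qubits is $\Phi_l(V)=\sum_jc_l(j)\arg\det V_j \bmod 2\pi$. (1) Let $V\in\mathcal V^{(n)}$ and $\widetilde V\in\mathcal V^{(n+1)}$, and let $|\eta\rangle$ be a state of one ancilla qubit $a$ such that $\widetilde V$ implements $V$ on the system: for every state $|\psi\rangle$ of the $n$ qubits there is an ancilla state $|\eta'\rangle$ (possibly depending on $\psi$) with $\widetilde V(|\psi\rangle\otimes|\eta\rangle)=(V|\psi\rangle)\otimes|\eta'\rangle$. Then there is a phase $c$, $|c|=1$, independent of $\psi$, such that $\widetilde V(|\psi\rangle\otimes|\eta\rangle)=(V|\psi\rangle)\otimes c|\eta\rangle$ for all $|\psi\rangle$ and $\widetilde V=c\,(V\otimes I_a)$, and $\Phi_l(\widetilde V)=2\Phi_l(V)$ mod $2\pi$ for all even $l\ge2$. (2) If moreover $|\eta'\rangle=|\eta\rangle$ for all $|\psi\rangle$ (the phase having been absorbed in $\widetilde V$), then $\widetilde V=V\otimes I_a$, and $\Phi_l(\widetilde V)=2\Phi_l(V)$ mod $2\pi$ for all even $l\ge0$. (3) For generic $V\in\mathcal V^{(n)}$,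 that is, for all $V$ in a dense open subset of $\mathcal V^{(n)}$ whose complement has Haar measure zero, all phases $\Phi_l(V\otimes I_a)$, $l=0,2,\dots,2\lfloor n/2\rfloor$, are non-zero modulo $2\pi$, and for every $k<2\lfloor n/2\rfloor$: $V\otimes I_a\notin\mathcal V^{(n+1)}_k$, and no $\widetilde V\in\mathcal V^{(n+1)}_k$ implements $V$ in the sense of (1) with any initial ancilla state $|\eta\rangle$. (4) Hence one ancilla qubit does not give universality: for every $k<2\lfloor n/2\rfloor$ there is $V\in\mathcal V^{(n)}$ that cannot be implemented by $k$-local symmetric unitaries on the $n$ qubits and one ancilla qubit. -/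

import Mathlib

open MeasureTheory

namespace SpinQubit

/-- Labels of the computational basis of `n` qubits. -/
abbrev Bits (n : ℕ) : Type := Fin n → Fin 2

/-- The Hilbert space `(ℂ²)^{⊗ n}` of `n` qubits. -/
abbrev Hilb (n : ℕ) : Type := EuclideanSpace ℂ (Bits n)

/-- Operators on `n` qubits, as matrices in the computational basis. -/
abbrev Op (n : ℕ) : Type := Matrix (Bits n) (Bits n) ℂ

/-- The action of an operator on state vectors. -/
noncomputable def act {n : ℕ} (A : Op n) : Hilb n →ₗ[ℂ] Hilb n := Matrix.toEuclideanLin A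

/-! ### Tensor products -/

/-- `A₁ ⊗ ⋯ ⊗ Aₙ` for single-qubit operators `Aᵢ`. -/
def tensorOp {n : ℕ} (A : Fin n → Matrix (Fin 2) (Fin 2) ℂ) : Op n :=
  Matrix.of fun x y => ∏ i, A i (x i) (y i)

/-- The single-qubit operator `A` on qubit `i`, tensor the identity on the other qubits. -/
def site {n : ℕ} (i : Fin n) (A : Matrix (Fin 2) (Fin 2) ℂ) : Op n :=
  tensorOp (Function.update (fun _ => 1) i A)

/-- `ψ ⊗ η`: `n` system qubits in state `ψ`, and an ancilla (the last qubit) in state `η`. -/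
noncomputable def withAncilla {n : ℕ} (ψ : Hilb n) (η : EuclideanSpace ℂ (Fin 2)) :
    Hilb (n + 1) :=
  WithLp.toLp 2 fun x => ψ (Fin.init x) * η (x (Fin.last n))

/-- `A ⊗ I_a`: the operator `A` on the system, the identity on the ancilla (the last qubit). -/
def extendByOne {n : ℕ} (A : Op n) : Op (n + 1) :=
  Matrix.of fun x y => A (Fin.init x) (Fin.init y) * (1 : Matrix (Fin 2) (Fin 2) ℂ)
    (x (Fin.last n)) (y (Fin.last n))

/-! ### Rotational invariance and locality -/

/-- `[A, U^{⊗ n}] = 0` for all single-qubit unitaries `U`. -/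
def IsRotInvariant {n : ℕ} (A : Op n) : Prop :=
  ∀ U ∈ Matrix.unitaryGroup (Fin 2) ℂ, Commute A (tensorOp fun _ => U)

/-- `A` acts non-trivially on at most `k` qubits: `A = B ⊗ I` with `B` an operator on a set `S` of
at most `k` qubits, and `I` the identity on the qubits outside `S`. -/
def IsLocal {n : ℕ} (k : ℕ) (A : Op n) : Prop :=
  ∃ S : Finset (Fin n), S.card ≤ k ∧ ∃ B : Matrix (S → Fin 2) (S → Fin 2) ℂ,
    ∀ x y : Bits n, A x y =
      if ∀ i, i ∉ S → x i = y i then B (fun i => x i) (fun i => y i) else 0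

/-- The group of all rotationally-invariant unitaries on `n` qubits. -/
def symUnitary (n : ℕ) : Subgroup (Matrix.unitaryGroup (Bits n) ℂ) where
  carrier := {V | IsRotInvariant (V : Op n)}
  one_mem' := fun U _ => Commute.one_left _
  mul_mem' := fun ha hb U hU => (ha U hU).mul_left (hb U hU)
  inv_mem' := by
    intro V hV U hU
    have h := hV U hU
    have h1 : ((V⁻¹ : Matrix.unitaryGroup (Bits n) ℂ) : Op n) * (V : Op n) = 1 := by
      rw [← Submonoid.coe_mul, inv_mul_cancel]; rfl
    have h2 : (V : Op n) * ((V⁻¹ : Matrix.unitaryGroup (Bits n) ℂ) : Op n) = 1 := by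
      rw [← Submonoid.coe_mul, mul_inv_cancel]; rfl
    exact Commute.units_inv_left (u := ⟨(V : Op n), _, h2, h1⟩) h

/-- The group generated by composing finitely many `k`-local rotationally-invariant unitaries
on `n` qubits. -/
def localSymUnitary (n k : ℕ) : Subgroup (Matrix.unitaryGroup (Bits n) ℂ) :=
  Subgroup.closure {V | IsRotInvariant (V : Op n) ∧ IsLocal k (V : Op n)}

/-! ### Angular momentum -/

/-- The Pauli matrices `σ^(x), σ^(y), σ^(z)`. -/
def pauli : Fin 3 → Matrix (Fin 2) (Fin 2) ℂ :=
  ![!![0, 1; 1, 0], !![0, -Complex.I; Complex.I, 0], !![1, 0; 0, -1]]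

/-- `J_v = (1/2) ∑ᵢ σᵢ^(v)`. -/
noncomputable def angMom (n : ℕ) (v : Fin 3) : Op n := (1 / 2 : ℂ) • ∑ i, site i (pauli v)

/-- `J² = J_x² + J_y² + J_z²`. -/
noncomputable def angMomSq (n : ℕ) : Op n := ∑ v, angMom n v ^ 2

/-- `H_j`: the eigenspace of `J²` with eigenvalue `j (j + 1)`. -/
noncomputable def sector (n : ℕ) (j : ℝ) : Submodule ℂ (Hilb n) :=
  Module.End.eigenspace (act (angMomSq n)) ((j * (j + 1) : ℝ) : ℂ)

/-- `Π_j`: the orthogonal projection onto `H_j`. -/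
noncomputable def sectorProj (n : ℕ) (j : ℝ) : Hilb n →ₗ[ℂ] Hilb n :=
  ((sector n j).starProjection : Hilb n →L[ℂ] Hilb n)

/-- The component `V_j` of an operator `V` inside `H_j`. -/
noncomputable def sectorPart {n : ℕ} (V : Op n) (j : ℝ) : sector n j →ₗ[ℂ] sector n j :=
  ((sector n j).orthogonalProjectionOnto : Hilb n →ₗ[ℂ] sector n j) ∘ₗ act V ∘ₗ (sector n j).subtype

/-! ### The operators `C_l` and the `l`-body phases -/

/-- The exchange interaction `R_{rs} = (1/2) ∑_v σ_r^(v) σ_s^(v)`. -/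
noncomputable def exchange {n : ℕ} (r s : Fin n) : Op n :=
  (1 / 2 : ℂ) • ∑ v, site r (pauli v) * site s (pauli v)

/-- `C_l = (1/(l/2)!) ∑ R_{i₁i₂} ⋯ R_{i_{l-1}i_l}` for even `l`, the sum being over all `l`-tuples
of distinct qubits. Thus `C_0 = 1`, and `C_l = 0` for `l > n`. -/
noncomputable def bodyOp (n l : ℕ) : Op n :=
  (1 / (Nat.factorial (l / 2) : ℂ)) • ∑ i : Fin l ↪ Fin n,
    (List.ofFn fun r : Fin (l / 2) =>
      exchange (i ⟨2 * r, by omega⟩) (i ⟨2 * r + 1, by omega⟩)).prod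

/-- `c_l(j) = Tr(C_l Π_j) / Tr(Π_j)`, the (real) eigenvalue of `C_l` on `H_j`. -/
noncomputable def bodyEigenvalue (n l : ℕ) (j : ℝ) : ℝ :=
  (LinearMap.trace ℂ (Hilb n) (act (bodyOp n l) ∘ₗ sectorProj n j) /
    LinearMap.trace ℂ (Hilb n) (sectorProj n j)).re

/-- The `l`-body phase `Φ_l = ∑_j c_l(j) arg(det V_j)`, modulo `2π`, for even `l`. The sum is over
`j = n/2, n/2 - 1, …, j_min`, where `j_min` is `0` for even `n` and `1/2` for odd `n`. -/
noncomputable def bodyPhase {n : ℕ} (l : ℕ) (V : Op n) : Real.Angle :=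
  ((∑ r ∈ Finset.range (n / 2 + 1),
    bodyEigenvalue n l ((n : ℝ) / 2 - r) *
      Complex.arg (LinearMap.det (sectorPart V ((n : ℝ) / 2 - r))) : ℝ) : Real.Angle)

/-! ### One ancilla -/

/-- With the ancilla prepared in `η`, the unitary `W` on `n + 1` qubits implements `V` on the
system: for every initial state `ψ` of the system, the final state is `V ψ` on the system, tensor
some state `η'` of the ancilla, which is allowed to depend on `ψ`. -/
def Implements {n : ℕ} (W : Op (n + 1)) (V : Op n) (η : EuclideanSpace ℂ (Fin 2)) : Prop :=
  ∀ ψ : Hilb n, ‖ψ‖ = 1 → ∃ η' : EuclideanSpace ℂ (Fin 2), ‖η'‖ = 1 ∧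
    act W (withAncilla ψ η) = withAncilla (act V ψ) η'

/-- `V` can be implemented with `k`-local rotationally-invariant unitaries on the `n` system qubits
and one ancilla qubit. -/
def ImplementableWithAncilla {n : ℕ} (k : ℕ) (V : Op n) : Prop :=
  ∃ W ∈ localSymUnitary (n + 1) k, ∃ η : EuclideanSpace ℂ (Fin 2), ‖η‖ = 1 ∧
    Implements (W : Op (n + 1)) V η

/-- A property of the elements of a topological group is generic if it holds on a dense open set
whose complement is null for Haar measure. -/
def IsGeneric {G : Type*} [Group G] [TopologicalSpace G] (S : Set G) : Prop :=
  IsOpen S ∧ Dense S ∧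
    ∀ (_ : MeasurableSpace G) (_ : BorelSpace G) (μ : Measure G), μ.IsHaarMeasure → μ Sᶜ = 0

end SpinQubit

open SpinQubit

namespace SpinQubit

/-! ### Products of local operators -/

variable {n : ℕ}

/-! Rigidity of the ancilla. If W implements V, then X = (V⁻¹ ⊗ I) W maps every ψ ⊗ η to ψ ⊗ η', and
linearity makes η' independent of ψ. As X commutes with each collective operator B_sys ⊗ I + I ⊗ B,
and the system term contributes equally to both sides, X (ψ ⊗ Bη) = ψ ⊗ Bη' for every 2 × 2 matrix
B. Taking B = |φ⟩⟨η| shows that X is the scalar ⟨η, η'⟩, so W = c (V ⊗ I)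
(`eq_smul_one_of_commute_total`, `Implements.exists_phase`).

The phases. On each sector `C_l` is an integer scalar. It is a scalar because a symmetrized operator
lies in the algebra generated by the collective operators (`sum_mem_collective`), and an element of
this algebra commuting with the spin operators is scalar on Casimir eigenspaces by highest-weight
theory. The scalar is an integer because `C_l` has integer entries and J² has rational ones
(`exists_int_bodyEigenvalue`). Integrality makes Φ_l a homomorphism into the circle, with
Φ_l(exp(iH)) = Tr(C_l H) for Hermitian H commuting with J² (`bodyPhase_expI`). Every unitary has a
Hermitian logarithm commuting with all that it commutes with, so symmetry and locality pass to H.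

Everything then reduces to traces. Since Σ_w σ_w σ_v σ_w = -σ_v, a term of `C_l` has zero trace
against any operator that is trivial on one of the qubits of that term. Hence Φ_l vanishes on
k-local unitaries for k < l, global phases are invisible for l ≥ 2, and only tuples avoiding the
ancilla contribute to Φ_l(V ⊗ I), which gives the factor 2.

Genericity. Along exp(itC_l) the phase is t Tr(C_l²), and Tr(C_l²) ≠ 0 for l ≤ n. So Φ_l(V ⊗ I) is a
nontrivial continuous character on a compact group, non-zero on a dense open set of full measure
(`isGeneric_ne_zero`). The phase with l = 2⌊n/2⌋ alone obstructs every k < l. -/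

theorem tensorOp_apply (A : Fin n → Matrix (Fin 2) (Fin 2) ℂ) (x y : Bits n) :
    tensorOp A x y = ∏ i, A i (x i) (y i) := rfl

theorem tensorOp_mul (A B : Fin n → Matrix (Fin 2) (Fin 2) ℂ) :
    tensorOp A * tensorOp B = tensorOp fun i => A i * B i := by
  ext x y
  simp only [Matrix.mul_apply, tensorOp_apply, ← Finset.prod_mul_distrib]
  rw [Finset.prod_univ_sum]
  simp [Fintype.piFinset_univ]

theorem tensorOp_one : tensorOp (fun _ : Fin n => (1 : Matrix (Fin 2) (Fin 2) ℂ)) = 1 := by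
  ext x y
  simp only [tensorOp_apply, Matrix.one_apply]
  rw [Finset.prod_ite_zero]
  simp [funext_iff]

theorem site_apply (i : Fin n) (A : Matrix (Fin 2) (Fin 2) ℂ) (x y : Bits n) :
    site i A x y = if ∀ j, j ≠ i → x j = y j then A (x i) (y i) else 0 := by
  rw [site, tensorOp_apply, ← Finset.mul_prod_erase _ _ (Finset.mem_univ i)]
  rw [Finset.prod_congr rfl (g := fun j => if x j = y j then (1 : ℂ) else 0)]
  · rw [Finset.prod_ite_zero]
    simp
  · intro j hj
    simp [Function.update_of_ne (Finset.ne_of_mem_erase hj), Matrix.one_apply]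

theorem site_mul_site (i : Fin n) (A B : Matrix (Fin 2) (Fin 2) ℂ) :
    site i A * site i B = site i (A * B) := by
  rw [site, site, site, tensorOp_mul]
  congr 1
  ext1 j
  rcases eq_or_ne j i with rfl | h <;> simp [*]

theorem site_one (i : Fin n) : site i 1 = (1 : Op n) := by
  rw [site, Function.update_eq_self_iff.2 rfl, tensorOp_one]

theorem commute_site {i j : Fin n} (h : i ≠ j) (A B : Matrix (Fin 2) (Fin 2) ℂ) :
    Commute (site i A) (site j B) := by
  rw [Commute, SemiconjBy, site, site, tensorOp_mul, tensorOp_mul]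
  congr 1
  ext1 k
  rcases eq_or_ne k i with rfl | h1
  · simp [h]
  · rcases eq_or_ne k j with rfl | h2 <;> simp [*]

/-- `site i` as a linear map. -/
def siteLin (i : Fin n) : Matrix (Fin 2) (Fin 2) ℂ →ₗ[ℂ] Op n where
  toFun := site i
  map_add' A B := by
    ext x y
    simp only [site_apply, Matrix.add_apply]
    split_ifs <;> simp
  map_smul' c A := by
    ext x y
    simp only [site_apply, Matrix.smul_apply, RingHom.id_apply]
    split_ifs <;> simp

theorem siteLin_apply (i : Fin n) (A : Matrix (Fin 2) (Fin 2) ℂ) : siteLin i A = site i A := rfl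

theorem site_conjTranspose (i : Fin n) (A : Matrix (Fin 2) (Fin 2) ℂ) :
    (site i A).conjTranspose = site i A.conjTranspose := by
  ext x y
  simp only [site_apply, Matrix.conjTranspose_apply]
  simp only [eq_comm]
  split_ifs <;> simp

/-- The collective operator `∑ᵢ Aᵢ`. -/
def total (n : ℕ) : Matrix (Fin 2) (Fin 2) ℂ →ₗ[ℂ] Op n := ∑ i, siteLin i

theorem total_apply (A : Matrix (Fin 2) (Fin 2) ℂ) : total n A = ∑ i, site i A := by
  simp [total, siteLin_apply]

/-- Operators on distinct qubits commute, so only the diagonal terms survive: `total` is the Lie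
algebra representation on the tensor power. -/
theorem total_mul_sub (A B : Matrix (Fin 2) (Fin 2) ℂ) :
    total n A * total n B - total n B * total n A = total n (A * B - B * A) := by
  rw [map_sub]
  simp only [total_apply, Finset.sum_mul_sum]
  rw [Finset.sum_comm (f := fun i j => site i B * site j A), ← Finset.sum_sub_distrib,
    ← Finset.sum_sub_distrib]
  refine Finset.sum_congr rfl fun i _ => ?_
  rw [← Finset.sum_sub_distrib, Finset.sum_eq_single i]
  · rw [site_mul_site, site_mul_site]
  · intro j _ hj
    rw [sub_eq_zero]
    exact commute_site hj.symm A B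
  · simp

theorem total_conjTranspose (A : Matrix (Fin 2) (Fin 2) ℂ) :
    (total n A).conjTranspose = total n A.conjTranspose := by
  simp [total_apply, Matrix.conjTranspose_sum, site_conjTranspose]

theorem total_one : total n 1 = (n : ℂ) • (1 : Op n) := by
  simp [total_apply, site_one, Nat.cast_smul_eq_nsmul]

/-! ### Ladder operators and J² as a Casimir operator. -/

theorem angMom_eq (v : Fin 3) : angMom n v = total n ((1 / 2 : ℂ) • pauli v) := by
  rw [map_smul, total_apply, angMom]

/-- The raising operator `J₊`. -/
def raising (n : ℕ) : Op n := total n !![0, 1; 0, 0]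

/-- The lowering operator `J₋`. -/
def lowering (n : ℕ) : Op n := total n !![0, 0; 1, 0]

/-- The operator `J_z`. -/
noncomputable def weightOp (n : ℕ) : Op n := total n ((1 / 2 : ℂ) • !![1, 0; 0, -1])

theorem raising_mul_lowering :
    raising n * lowering n = lowering n * raising n + (2 : ℂ) • weightOp n := by
  rw [← sub_eq_iff_eq_add', raising, lowering, total_mul_sub, weightOp, ← map_smul]
  congr 1
  ext i j
  fin_cases i <;> fin_cases j <;> simp

theorem weightOp_mul_raising :
    weightOp n * raising n = raising n * weightOp n + raising n := by
  rw [← sub_eq_iff_eq_add', raising, weightOp, total_mul_sub]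
  congr 1
  ext i j
  fin_cases i <;> fin_cases j <;> simp
  norm_num

theorem weightOp_mul_lowering :
    weightOp n * lowering n = lowering n * weightOp n - lowering n := by
  rw [sub_eq_add_neg, ← sub_eq_iff_eq_add', lowering, weightOp, total_mul_sub, ← map_neg]
  congr 1
  ext i j
  fin_cases i <;> fin_cases j <;> simp
  norm_num

/-- The order with J₊ on the right makes the value on a highest-weight vector immediate. -/
theorem angMomSq_eq :
    angMomSq n = lowering n * raising n + weightOp n * weightOp n + weightOp n := by
  have hx : angMom n 0 = (1 / 2 : ℂ) • (raising n + lowering n) := by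
    rw [angMom_eq, map_smul, raising, lowering, ← map_add]
    congr 2
    ext i j
    fin_cases i <;> fin_cases j <;> simp [pauli]
  have hy : angMom n 1 = (-Complex.I / 2 : ℂ) • (raising n - lowering n) := by
    rw [angMom_eq, raising, lowering, ← map_sub, ← map_smul]
    congr 1
    ext i j
    fin_cases i <;> fin_cases j <;> simp [pauli] <;> ring
  have hz : angMom n 2 = weightOp n := by
    rw [angMom_eq, weightOp]
    rfl
  rw [angMomSq, Fin.sum_univ_three, hx, hy, hz]
  simp only [pow_two, smul_mul_smul_comm, add_mul, mul_add, sub_mul, mul_sub, raising_mul_lowering]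
  have : (-Complex.I / 2) * (-Complex.I / 2) = (-(1 / 4) : ℂ) := by
    linear_combination (1 / 4 : ℂ) * Complex.I_mul_I
  rw [this]
  module

theorem raising_conjTranspose : (raising n).conjTranspose = lowering n := by
  rw [raising, total_conjTranspose, lowering]
  congr 1
  ext i j
  fin_cases i <;> fin_cases j <;> simp

theorem weightOp_conjTranspose : (weightOp n).conjTranspose = weightOp n := by
  rw [weightOp, total_conjTranspose]
  congr 1
  ext i j
  fin_cases i <;> fin_cases j <;> simp

/-! ### Rotational invariance in terms of generators. -/

theorem matrix_two_eq (A : Matrix (Fin 2) (Fin 2) ℂ) :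
    A = ((A 0 0 + A 1 1) / 2) • (1 : Matrix (Fin 2) (Fin 2) ℂ) + ((A 0 1 + A 1 0) / 2) • pauli 0
      + (Complex.I * (A 0 1 - A 1 0) / 2) • pauli 1 + ((A 0 0 - A 1 1) / 2) • pauli 2 := by
  ext i j
  fin_cases i <;> fin_cases j <;> simp [pauli]
  · ring
  · linear_combination ((A 0 1 - A 1 0) / 2) * Complex.I_mul_I
  · linear_combination (-(A 0 1 - A 1 0) / 2) * Complex.I_mul_I
  · ring

theorem pauli_conjTranspose (v : Fin 3) : (pauli v).conjTranspose = pauli v := by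
  ext i j
  fin_cases v <;> fin_cases i <;> fin_cases j <;> simp [pauli]

theorem pauli_mul_self (v : Fin 3) : pauli v * pauli v = 1 := by
  ext i j
  fin_cases v <;> fin_cases i <;> fin_cases j <;> simp [pauli]

theorem commute_total_of_commute_pauli {A : Op n} (h : ∀ v, Commute A (total n (pauli v)))
    (B : Matrix (Fin 2) (Fin 2) ℂ) : Commute A (total n B) := by
  rw [matrix_two_eq B]
  simp only [map_add, map_smul, total_one]
  exact (((((Commute.one_right A).smul_right _).smul_right _).add_right
    ((h 0).smul_right _)).add_right ((h 1).smul_right _)).add_right ((h 2).smul_right _)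

/-- Product rule: when one factor is differentiated at 0, all the others equal the identity. -/
theorem hasDerivAt_tensorOp {U : ℝ → Matrix (Fin 2) (Fin 2) ℂ} {U' : Matrix (Fin 2) (Fin 2) ℂ}
    (h0 : U 0 = 1) (h : ∀ a b, HasDerivAt (fun t => U t a b) (U' a b) 0) (x y : Bits n) :
    HasDerivAt (fun t => tensorOp (fun _ : Fin n => U t) x y) (total n U' x y) 0 := by
  have := HasDerivAt.fun_finsetProd (u := Finset.univ) (f := fun (i : Fin n) t => U t (x i) (y i))
    (f' := fun i => U' (x i) (y i)) (x := (0 : ℝ)) (fun i _ => h _ _)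
  refine this.congr_deriv ?_
  rw [total_apply, Matrix.sum_apply]
  refine Finset.sum_congr rfl fun i _ => ?_
  rw [site_apply, Finset.prod_congr rfl (g := fun j => if x j = y j then (1 : ℂ) else 0),
    Finset.prod_ite_zero]
  · simp
  · intro j _
    rw [h0, Matrix.one_apply]

/-- Rotational invariance at the infinitesimal level. -/
theorem IsRotInvariant.commute_total {A : Op n} (hA : IsRotInvariant A)
    (B : Matrix (Fin 2) (Fin 2) ℂ) : Commute A (total n B) := by
  refine commute_total_of_commute_pauli (fun v => ?_) B
  -- This is exp(i t σ_v), in closed form because σ_v² = 1. Differentiating the commutation relation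
  -- at t = 0 gives commutation with the generator.
  let U : ℝ → Matrix (Fin 2) (Fin 2) ℂ := fun t =>
    ((Real.cos t : ℝ) : ℂ) • 1 + (Complex.I * ((Real.sin t : ℝ) : ℂ)) • pauli v
  have hU : ∀ t, U t ∈ Matrix.unitaryGroup (Fin 2) ℂ := by
    intro t
    rw [Matrix.mem_unitaryGroup_iff, Matrix.star_eq_conjTranspose]
    simp only [U, Matrix.conjTranspose_add, Matrix.conjTranspose_smul, Matrix.conjTranspose_one,
      pauli_conjTranspose, add_mul, mul_add, smul_mul_smul_comm, pauli_mul_self, mul_one, one_mul]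
    have h1 : ((Real.cos t : ℝ) : ℂ) ^ 2 + ((Real.sin t : ℝ) : ℂ) ^ 2 = 1 := by
      exact_mod_cast Real.cos_sq_add_sin_sq t
    simp only [star_mul', Complex.star_def, Complex.conj_I, Complex.conj_ofReal]
    generalize ((Real.sin t : ℝ) : ℂ) = s at *
    generalize ((Real.cos t : ℝ) : ℂ) = c at *
    match_scalars
    · linear_combination h1 - s ^ 2 * Complex.I_mul_I
    · ring
  have h0 : U 0 = 1 := by simp [U]
  have hd : ∀ a b, HasDerivAt (fun t => U t a b) ((Complex.I • pauli v) a b) 0 := by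
    intro a b
    have hc : HasDerivAt (fun t : ℝ => ((Real.cos t : ℝ) : ℂ)) 0 0 := by
      simpa using (Real.hasDerivAt_cos 0).ofReal_comp
    have hs : HasDerivAt (fun t : ℝ => ((Real.sin t : ℝ) : ℂ)) 1 0 := by
      simpa using (Real.hasDerivAt_sin 0).ofReal_comp
    have := (hc.mul_const ((1 : Matrix (Fin 2) (Fin 2) ℂ) a b)).add
      ((hs.const_mul Complex.I).mul_const (pauli v a b))
    exact this.congr_deriv (by simp)
  have key : A * total n (Complex.I • pauli v) = total n (Complex.I • pauli v) * A := by
    ext x y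
    have h1 : HasDerivAt (fun t : ℝ => (A * tensorOp (fun _ => U t) : Op n) x y)
        ((A * total n (Complex.I • pauli v)) x y) 0 := by
      simp only [Matrix.mul_apply]
      exact HasDerivAt.fun_sum fun z _ => (hasDerivAt_tensorOp h0 hd z y).const_mul _
    have h2 : HasDerivAt (fun t : ℝ => (tensorOp (fun _ => U t) * A : Op n) x y)
        ((total n (Complex.I • pauli v) * A) x y) 0 := by
      simp only [Matrix.mul_apply]
      exact HasDerivAt.fun_sum fun z _ => (hasDerivAt_tensorOp h0 hd x z).mul_const _
    refine h1.unique ?_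
    have : (fun t : ℝ => (A * tensorOp (fun _ => U t) : Op n) x y)
      = fun t : ℝ => (tensorOp (fun _ => U t) * A : Op n) x y := by
      ext t
      rw [(hA _ (hU t)).eq]
    rw [this]
    exact h2
  rw [map_smul] at key
  have h3 : Commute A (Complex.I • total n (pauli v)) := key
  simpa [smul_smul] using h3.smul_right (-Complex.I)

/-! ### Permutation operators -/

/-- The operator permuting the qubits. -/
def permOp (σ : Equiv.Perm (Fin n)) : Op n := Matrix.of fun x y => if x ∘ σ = y then 1 else 0

theorem permOp_mul_apply (σ : Equiv.Perm (Fin n)) (A : Op n) (x y : Bits n) :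
    (permOp σ * A) x y = A (x ∘ σ) y := by
  simp [Matrix.mul_apply, permOp]

theorem mul_permOp_apply (σ : Equiv.Perm (Fin n)) (A : Op n) (x y : Bits n) :
    (A * permOp σ) x y = A x (y ∘ σ.symm) := by
  rw [Matrix.mul_apply, Finset.sum_eq_single (y ∘ σ.symm)]
  · simp [permOp, Function.comp_assoc]
  · intro z _ hz
    have : z ∘ σ ≠ y := by
      rintro rfl
      exact hz (by ext; simp)
    simp [permOp, this]
  · simp

theorem commute_permOp_tensorOp (σ : Equiv.Perm (Fin n)) (U : Matrix (Fin 2) (Fin 2) ℂ) :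
    Commute (permOp σ) (tensorOp fun _ => U) := by
  rw [Commute, SemiconjBy]
  ext x y
  rw [permOp_mul_apply, mul_permOp_apply, tensorOp_apply, tensorOp_apply]
  exact Fintype.prod_equiv σ _ _ (by simp)

/-- Pauli completeness: Σ σ_v ⊗ σ_v is twice the swap minus the identity. -/
theorem sum_pauli_mul_pauli (a b c d : Fin 2) :
    ∑ v, pauli v a b * pauli v c d
      = 2 * (if a = d ∧ c = b then 1 else 0) - if a = b ∧ c = d then 1 else 0 := by
  fin_cases a <;> fin_cases b <;> fin_cases c <;> fin_cases d <;>
    simp [Fin.sum_univ_three, pauli] <;> norm_num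

theorem site_mul_site_apply {r s : Fin n} (h : r ≠ s) (A B : Matrix (Fin 2) (Fin 2) ℂ)
    (x y : Bits n) : (site r A * site s B) x y
      = if ∀ j, j ≠ r → j ≠ s → x j = y j then A (x r) (y r) * B (x s) (y s) else 0 := by
  rw [site, site, tensorOp_mul, tensorOp_apply, ← Finset.mul_prod_erase _ _ (Finset.mem_univ r),
    ← Finset.mul_prod_erase _ _ (Finset.mem_erase.2 ⟨h.symm, Finset.mem_univ s⟩),
    Finset.prod_congr rfl (g := fun j => if x j = y j then (1 : ℂ) else 0), Finset.prod_ite_zero]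
  · simp [h, h.symm, imp.swap]
  · intro j hj
    simp only [Finset.mem_erase, Finset.mem_univ, and_true] at hj
    simp [hj.1, hj.2, Matrix.one_apply]

/-- Two facts follow from this form: exchanges commute with every U^{⊗ n}, and their doubles have
integer entries. -/
theorem exchange_eq {r s : Fin n} (h : r ≠ s) :
    exchange r s = permOp (Equiv.swap r s) - (1 / 2 : ℂ) • 1 := by
  ext x y
  simp only [exchange, Matrix.smul_apply, Matrix.sum_apply, site_mul_site_apply h,
    Matrix.sub_apply, permOp, Matrix.of_apply, Matrix.one_apply]
  by_cases hxy : ∀ j, j ≠ r → j ≠ s → x j = y j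
  · have e1 : x ∘ Equiv.swap r s = y ↔ x r = y s ∧ x s = y r := by
      constructor
      · rintro rfl
        simp
      · rintro ⟨h1, h2⟩
        ext1 j
        rcases eq_or_ne j r with rfl | hr
        · simpa using h2
        · rcases eq_or_ne j s with rfl | hs
          · simpa using h1
          · simpa [Equiv.swap_apply_of_ne_of_ne hr hs] using hxy j hr hs
    have e2 : x = y ↔ x r = y r ∧ x s = y s := by
      constructor
      · rintro rfl
        simp
      · rintro ⟨h1, h2⟩
        ext1 j
        rcases eq_or_ne j r with rfl | hr
        · exact h1
        · rcases eq_or_ne j s with rfl | hs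
          · exact h2
          · exact hxy j hr hs
    simp only [if_pos hxy, sum_pauli_mul_pauli, e1, e2, smul_eq_mul]
    split_ifs <;> norm_num
  · have e1 : ¬ x ∘ Equiv.swap r s = y := by
      rintro rfl
      exact hxy fun j hr hs => by simp [Equiv.swap_apply_of_ne_of_ne hr hs]
    have e2 : ¬ x = y := by
      rintro rfl
      exact hxy fun j _ _ => rfl
    simp [if_neg hxy, e1, e2]

theorem commute_exchange_tensorOp {r s : Fin n} (h : r ≠ s) (U : Matrix (Fin 2) (Fin 2) ℂ) :
    Commute (exchange r s) (tensorOp fun _ => U) := by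
  rw [exchange_eq h]
  exact (commute_permOp_tensorOp _ U).sub_left ((Commute.one_left _).smul_left _)

/-- The purpose is arithmetic: exchanges have rational entries, while those of J_y are imaginary. -/
theorem angMomSq_eq_exchange : angMomSq n = (3 * n / 4 : ℂ) • 1
    + (1 / 2 : ℂ) • ∑ r, ∑ s ∈ Finset.univ.erase r, exchange r s := by
  have h1 : ∀ v, angMom n v ^ 2 = (n / 4 : ℂ) • 1 + ∑ r, ∑ s ∈ Finset.univ.erase r,
      (1 / 4 : ℂ) • (site r (pauli v) * site s (pauli v)) := by
    intro v
    rw [angMom, pow_two, smul_mul_smul_comm, Finset.sum_mul_sum, Finset.smul_sum]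
    have : ∀ r : Fin n, (1 / 2 * (1 / 2) : ℂ) • ∑ s, site r (pauli v) * site s (pauli v)
        = (1 / 4 : ℂ) • 1 + ∑ s ∈ Finset.univ.erase r,
          (1 / 4 : ℂ) • (site r (pauli v) * site s (pauli v)) := by
      intro r
      rw [← Finset.add_sum_erase _ _ (Finset.mem_univ r), site_mul_site, pauli_mul_self, site_one,
        smul_add, Finset.smul_sum]
      norm_num
    rw [Finset.sum_congr rfl fun r _ => this r, Finset.sum_add_distrib]
    congr 1
    simp only [Finset.sum_const, Finset.card_univ, Fintype.card_fin, ← Nat.cast_smul_eq_nsmul ℂ,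
      smul_smul]
    congr 1
    ring
  rw [angMomSq, Finset.sum_congr rfl fun v _ => h1 v, Finset.sum_add_distrib, Finset.sum_comm]
  congr 1
  · simp only [Finset.sum_const, Finset.card_univ, Fintype.card_fin, ← Nat.cast_smul_eq_nsmul ℂ,
      smul_smul]
    congr 1
    push_cast
    ring
  · rw [Finset.smul_sum]
    refine Finset.sum_congr rfl fun r _ => ?_
    rw [Finset.sum_comm, Finset.smul_sum]
    refine Finset.sum_congr rfl fun s _ => ?_
    rw [exchange, smul_smul, ← Finset.smul_sum]
    norm_num

end SpinQubit

namespace SpinQubit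

/-! ### Highest-weight theory -/

open scoped InnerProductSpace

/-- Operators `J_z`, `J₊`, `J₋` with the commutation and adjointness relations of angular
momentum. -/
structure IsSpinTriple {E : Type*} [NormedAddCommGroup E] [InnerProductSpace ℂ E]
    (Z P M : Module.End ℂ E) : Prop where
  symm : Z.IsSymmetric
  adj : ∀ x y, ⟪P x, y⟫_ℂ = ⟪x, M y⟫_ℂ
  raise_lower : P * M = M * P + (Z + Z)
  weight_raise : Z * P = P * Z + P
  weight_lower : Z * M = M * Z - M

theorem eigenspace_invariant {V : Type*} [AddCommGroup V] [Module ℂ V] {C S : Module.End ℂ V}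
    {a : ℂ} (h : Commute C S) (w : V) (hw : w ∈ Module.End.eigenspace C a) :
    S w ∈ Module.End.eigenspace C a := by
  rw [Module.End.mem_eigenspace_iff] at hw ⊢
  rw [← Module.End.mul_apply, h.eq, Module.End.mul_apply, hw, map_smul]

namespace IsSpinTriple

variable {E : Type*} [NormedAddCommGroup E] [InnerProductSpace ℂ E] {Z P M : Module.End ℂ E}

/-- The Casimir operator. -/
def casimir (Z P M : Module.End ℂ E) : Module.End ℂ E := M * P + Z * Z + Z

theorem adj' (h : IsSpinTriple Z P M) (x y : E) : ⟪M x, y⟫_ℂ = ⟪x, P y⟫_ℂ := by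
  rw [← inner_conj_symm, ← h.adj, inner_conj_symm]

/-- Here and for the two ladder operators, the commutator is an explicit noncommutative combination
of the defining relations. -/
theorem commute_casimir_weight (h : IsSpinTriple Z P M) : Commute (casimir Z P M) Z := by
  rw [Commute, SemiconjBy, ← sub_eq_zero, casimir]
  have e : (M * P + Z * Z + Z) * Z - Z * (M * P + Z * Z + Z)
      = -(M * (Z * P - (P * Z + P))) - (Z * M - (M * Z - M)) * P := by noncomm_ring
  rw [e, h.weight_raise, h.weight_lower]
  simp

theorem commute_casimir_raise (h : IsSpinTriple Z P M) : Commute (casimir Z P M) P := by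
  rw [Commute, SemiconjBy, ← sub_eq_zero, casimir]
  have e : (M * P + Z * Z + Z) * P - P * (M * P + Z * Z + Z)
      = -(P * M - (M * P + (Z + Z))) * P + Z * (Z * P - (P * Z + P))
        + (Z * P - (P * Z + P)) * Z - (Z * P - (P * Z + P)) + (Z * P - (P * Z + P))
        - (Z * P - (P * Z + P)) + (Z * P - (P * Z + P)) := by
    noncomm_ring
  rw [e, h.weight_raise, h.raise_lower]
  simp

theorem commute_casimir_lower (h : IsSpinTriple Z P M) : Commute (casimir Z P M) M := by
  rw [Commute, SemiconjBy, ← sub_eq_zero, casimir]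
  have e : (M * P + Z * Z + Z) * M - M * (M * P + Z * Z + Z)
      = M * (P * M - (M * P + (Z + Z))) + Z * (Z * M - (M * Z - M))
        + (Z * M - (M * Z - M)) * Z  := by
    noncomm_ring
  rw [e, h.weight_lower, h.raise_lower]
  simp

/-- A highest-weight vector satisfies ‖Mv‖² = ⟨PMv, v⟩ = 2μ‖v‖², which cannot be negative. -/
theorem lowering_norm (h : IsSpinTriple Z P M) {v : E} {μ : ℝ} (hv : v ≠ 0)
    (hZ : Z v = (μ : ℂ) • v) (hP : P v = 0) : 0 ≤ μ := by
  have h1 : P (M v) = (2 * μ : ℂ) • v := by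
    have := congrArg (fun f : Module.End ℂ E => f v) h.raise_lower
    rw [two_mul, add_smul]
    simpa [hP, hZ] using this
  have h2 : ⟪P (M v), v⟫_ℂ = ⟪M v, M v⟫_ℂ := h.adj _ _
  rw [h1, inner_smul_left, inner_self_eq_norm_sq_to_K, inner_self_eq_norm_sq_to_K, map_mul,
    Complex.conj_ofReal, Complex.conj_ofNat] at h2
  have h3 : 2 * μ * ‖v‖ ^ 2 = ‖M v‖ ^ 2 := by
    have : ((2 * μ * ‖v‖ ^ 2 : ℝ) : ℂ) = ((‖M v‖ ^ 2 : ℝ) : ℂ) := by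
      push_cast
      simpa using h2
    exact_mod_cast this
  have h4 : 0 < ‖v‖ ^ 2 := by positivity
  nlinarith [sq_nonneg ‖M v‖]

theorem casimir_apply {v : E} {μ : ℝ} (hZ : Z v = (μ : ℂ) • v) (hP : P v = 0) :
    casimir Z P M v = ((μ * (μ + 1) : ℝ) : ℂ) • v := by
  simp only [casimir, LinearMap.add_apply, Module.End.mul_apply, hP, hZ, map_zero, map_smul]
  push_cast
  module

theorem weight_raise_apply (h : IsSpinTriple Z P M) {v : E} {μ : ℂ} (hZ : Z v = μ • v) :
    Z (P v) = (μ + 1) • P v := by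
  have := congrArg (fun f : Module.End ℂ E => f v) h.weight_raise
  simp only [Module.End.mul_apply, LinearMap.add_apply, hZ, map_smul] at this
  rw [this, add_smul, one_smul]

theorem weight_lower_apply (h : IsSpinTriple Z P M) {v : E} {μ : ℂ} (hZ : Z v = μ • v) :
    Z (M v) = (μ - 1) • M v := by
  have := congrArg (fun f : Module.End ℂ E => f v) h.weight_lower
  simp only [Module.End.mul_apply, LinearMap.sub_apply, hZ, map_smul] at this
  rw [this, sub_smul, one_smul]

theorem weight_lower_pow_apply (h : IsSpinTriple Z P M) {v : E} {μ : ℂ} (hZ : Z v = μ • v)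
    (k : ℕ) : Z ((M ^ k) v) = (μ - k) • (M ^ k) v := by
  induction k with
  | zero => simpa using hZ
  | succ k ih =>
    rw [pow_succ', Module.End.mul_apply, h.weight_lower_apply ih]
    push_cast
    congr 1
    ring

/-- The weights occurring in W are real, finite in number, and at least one exists. A vector of
largest weight is killed by P, which would raise the weight by one. -/
theorem exists_highest_weight [FiniteDimensional ℂ E] (h : IsSpinTriple Z P M) {W : Submodule ℂ E}
    (hW : W ≠ ⊥)
    (hZ : ∀ w ∈ W, Z w ∈ W) (hP : ∀ w ∈ W, P w ∈ W) :
    ∃ v ∈ W, v ≠ 0 ∧ ∃ μ : ℝ, 0 ≤ μ ∧ Z v = (μ : ℂ) • v ∧ P v = 0 := by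
  have hreal : ∀ (μ : ℂ) (v : E), v ≠ 0 → Z v = μ • v → ((μ.re : ℝ) : ℂ) = μ := by
    intro μ v hv hvμ
    refine Complex.conj_eq_iff_re.1 ?_
    exact h.symm.conj_eigenvalue_eq_self
      (Module.End.hasEigenvalue_of_hasEigenvector ⟨Module.End.mem_eigenspace_iff.2 hvμ, hv⟩)
  let A : Set ℝ := {μ | ∃ v ∈ W, v ≠ 0 ∧ Z v = (μ : ℂ) • v}
  have hfin : A.Finite := by
    refine ((Module.End.finite_hasEigenvalue Z).preimage
      (f := fun x : ℝ => (x : ℂ)) Complex.ofReal_injective.injOn).subset ?_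
    rintro μ ⟨v, -, hv, hvμ⟩
    exact Module.End.hasEigenvalue_of_hasEigenvector ⟨Module.End.mem_eigenspace_iff.2 hvμ, hv⟩
  have hne : A.Nonempty := by
    have : Nontrivial W := Submodule.nontrivial_iff_ne_bot.2 hW
    obtain ⟨μ, hμ⟩ := Module.End.exists_eigenvalue (Z.restrict hZ)
    obtain ⟨v, hv⟩ := hμ.exists_hasEigenvector
    have h1 : Z (v : E) = μ • (v : E) := by
      simpa using congrArg Subtype.val hv.apply_eq_smul
    have h2 : (v : E) ≠ 0 := by simpa using hv.2
    exact ⟨μ.re, v, v.2, h2, by rw [h1, hreal μ v h2 h1]⟩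
  obtain ⟨μ, ⟨v, hvW, hv, hvμ⟩, hmax⟩ := Set.exists_max_image A id hfin hne
  have hPv : P v = 0 := by
    by_contra hPv
    have := hmax (μ + 1) ⟨P v, hP v hvW, hPv, by
      rw [h.weight_raise_apply hvμ]
      push_cast
      rfl⟩
    simp only [id_eq] at this
    linarith
  exact ⟨v, hvW, hv, μ, h.lowering_norm hv hvμ hPv, hvμ, hPv⟩

/-- The span of the vectors M^k v is stable under the triple, hence under T. Its part of weight j is
the line of v, and T v keeps the weight j. -/
theorem apply_mem_span_of_highest_weight (h : IsSpinTriple Z P M) {T : Module.End ℂ E}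
    (hT : T ∈ Algebra.adjoin ℂ {Z, P, M}) (hTZ : Commute T Z) {v : E} {j : ℝ}
    (hZ : Z v = (j : ℂ) • v) (hP : P v = 0) : ∃ c : ℂ, T v = c • v := by
  let N : Submodule ℂ E := Submodule.span ℂ (Set.range fun k : ℕ => (M ^ k) v)
  have hMk : ∀ k, (M ^ k) v ∈ N := fun k => Submodule.subset_span ⟨k, rfl⟩
  have hgen : ∀ S : Module.End ℂ E, (∀ k, S ((M ^ k) v) ∈ N) → ∀ w ∈ N, S w ∈ N := by
    intro S hS w hw
    refine (Submodule.span_le (p := N.comap S)).2 ?_ hw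
    rintro _ ⟨k, rfl⟩
    exact hS k
  have hMN : ∀ w ∈ N, M w ∈ N := by
    refine hgen M fun k => ?_
    rw [← Module.End.mul_apply, ← pow_succ']
    exact hMk _
  have hZN : ∀ w ∈ N, Z w ∈ N := by
    refine hgen Z fun k => ?_
    rw [h.weight_lower_pow_apply hZ]
    exact N.smul_mem _ (hMk k)
  have hPN : ∀ w ∈ N, P w ∈ N := by
    refine hgen P fun k => ?_
    induction k with
    | zero => simp [hP]
    | succ k ih =>
      have := congrArg (fun f : Module.End ℂ E => f ((M ^ k) v)) h.raise_lower
      simp only [Module.End.mul_apply, LinearMap.add_apply] at this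
      rw [pow_succ', Module.End.mul_apply, this]
      exact N.add_mem (hMN _ ih) (N.add_mem (hZN _ (hMk k)) (hZN _ (hMk k)))
  have hTN : ∀ w ∈ N, T w ∈ N := by
    clear hTZ
    induction hT using Algebra.adjoin_induction with
    | mem S hS =>
      rcases hS with rfl | rfl | rfl
      · exact hZN
      · exact hPN
      · exact hMN
    | algebraMap r =>
      exact fun w hw => by simpa [Algebra.algebraMap_eq_smul_one] using N.smul_mem r hw
    | add S S' _ _ hS hS' => exact fun w hw => N.add_mem (hS w hw) (hS' w hw)
    | mul S S' _ _ hS hS' => exact fun w hw => hS _ (hS' w hw)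
  have horth : ∀ k w, Z w = (j : ℂ) • w → ⟪(M ^ (k + 1)) v, w⟫_ℂ = 0 := by
    intro k w hw
    have h1 := h.symm ((M ^ (k + 1)) v) w
    rw [h.weight_lower_pow_apply hZ, hw, inner_smul_left, inner_smul_right, ← sub_eq_zero,
      ← sub_mul] at h1
    refine (mul_eq_zero.1 h1).resolve_left ?_
    rw [map_sub, Complex.conj_ofReal, map_natCast, sub_sub_cancel_left, neg_eq_zero.not]
    exact_mod_cast k.succ_ne_zero
  -- Each element of N is a multiple of v up to a vector orthogonal to the whole weight-j space; for
  -- `T v`, itself of weight j, that remainder is zero.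
  have hdec : ∀ w ∈ N, ∃ c : ℂ, ∀ u, Z u = (j : ℂ) • u → ⟪w - c • v, u⟫_ℂ = 0 := by
    intro w hw
    induction hw using Submodule.span_induction with
    | mem _ hx =>
      obtain ⟨k, rfl⟩ := hx
      cases k with
      | zero => exact ⟨1, fun u _ => by simp⟩
      | succ k => exact ⟨0, fun u hu => by simpa using horth k u hu⟩
    | zero => exact ⟨0, fun u _ => by simp⟩
    | add x y _ _ hx hy =>
      obtain ⟨c, hc⟩ := hx
      obtain ⟨d, hd⟩ := hy
      refine ⟨c + d, fun u hu => ?_⟩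
      rw [add_smul, add_sub_add_comm, inner_add_left, hc u hu, hd u hu, add_zero]
    | smul a x _ hx =>
      obtain ⟨c, hc⟩ := hx
      refine ⟨a * c, fun u hu => ?_⟩
      rw [mul_smul, ← smul_sub, inner_smul_left, hc u hu, mul_zero]
  obtain ⟨c, hc⟩ := hdec (T v) (hTN v (hMk 0))
  refine ⟨c, sub_eq_zero.1 (inner_self_eq_zero.1 (hc _ ?_))⟩
  have h1 : Z (T v) = T (Z v) := congrArg (fun f : Module.End ℂ E => f v) hTZ.eq.symm
  rw [map_sub, h1, hZ, map_smul, map_smul, hZ, smul_sub, smul_comm]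

/-- A collective operator commuting with the angular momentum is scalar on the eigenspaces of the
Casimir operator. -/
theorem exists_smul_of_mem_adjoin [FiniteDimensional ℂ E] (h : IsSpinTriple Z P M)
    {T : Module.End ℂ E}
    (hT : T ∈ Algebra.adjoin ℂ {Z, P, M}) (hTZ : Commute T Z)
    (hTM : Commute T M) {j : ℝ} (hj : 0 ≤ j) : ∃ c : ℂ, ∀ v,
      casimir Z P M v = ((j * (j + 1) : ℝ) : ℂ) • v → T v = c • v := by
  have hscal : ∃ c : ℂ, ∀ v, Z v = (j : ℂ) • v → P v = 0 → T v = c • v := by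
    by_cases hex : ∃ v₀, v₀ ≠ 0 ∧ Z v₀ = (j : ℂ) • v₀ ∧ P v₀ = 0
    · obtain ⟨v₀, hv₀, hZ₀, hP₀⟩ := hex
      obtain ⟨c, hc⟩ := h.apply_mem_span_of_highest_weight hT hTZ hZ₀ hP₀
      refine ⟨c, fun v hZ hP => ?_⟩
      obtain ⟨a, ha⟩ := h.apply_mem_span_of_highest_weight hT hTZ hZ hP
      -- All highest-weight vectors are eigenvectors of T. Testing on v + v₀ shows that either the
      -- eigenvalues agree or v is a multiple of v₀.
      obtain ⟨b, hb⟩ := h.apply_mem_span_of_highest_weight hT hTZ (v := v + v₀) (j := j)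
        (by rw [map_add, hZ, hZ₀, smul_add]) (by rw [map_add, hP, hP₀, add_zero])
      rw [map_add, ha, hc] at hb
      by_cases hab : a = b
      · subst hab
        have : (c - a) • v₀ = 0 := by
          rw [sub_smul, sub_eq_zero]
          simpa using hb
        rw [ha, sub_eq_zero.1 ((smul_eq_zero.1 this).resolve_right hv₀)]
      · have h1 : v = ((a - b)⁻¹ * (b - c)) • v₀ := by
          rw [mul_smul, eq_inv_smul_iff₀ (sub_ne_zero.2 hab), sub_smul, sub_smul,
            sub_eq_sub_iff_add_eq_add,
            hb, smul_add, add_comm]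
        rw [h1, map_smul, hc, smul_comm]
    · push Not at hex
      refine ⟨0, fun v hZ hP => ?_⟩
      by_cases hv : v = 0
      · simp [hv]
      · exact absurd hP (hex v hv hZ)
  obtain ⟨c, hc⟩ := hscal
  refine ⟨c, ?_⟩
  let F : Submodule ℂ E := Module.End.eigenspace (casimir Z P M) ((j * (j + 1) : ℝ) : ℂ)
  let G : Submodule ℂ E := F ⊓ Module.End.eigenspace T c
  -- G is stable under Z and M, so its orthogonal complement is stable under the adjoints Z and P.
  -- If F ⊓ Gᗮ were nonzero it would contain a highest-weight vector, whose weight must be j since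
  -- both are nonnegative; but such a vector lies in G.
  have hW : F ⊓ Gᗮ = ⊥ := by
    by_contra hW
    obtain ⟨v, ⟨hvF, hvG⟩, hv, μ, hμ, hZ, hP⟩ := h.exists_highest_weight hW
      (fun w hw => ⟨eigenspace_invariant h.commute_casimir_weight w hw.1, fun g hg => by
        rw [← h.symm]
        exact hw.2 _ ⟨eigenspace_invariant h.commute_casimir_weight g hg.1,
          eigenspace_invariant hTZ g hg.2⟩⟩)
      (fun w hw => ⟨eigenspace_invariant h.commute_casimir_raise w hw.1, fun g hg => by
        rw [← h.adj']
        exact hw.2 _ ⟨eigenspace_invariant h.commute_casimir_lower g hg.1,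
          eigenspace_invariant hTM g hg.2⟩⟩)
    have hμj : μ = j := by
      have h1 := Module.End.mem_eigenspace_iff.1 hvF
      rw [casimir_apply hZ hP] at h1
      have h2 := smul_left_injective ℂ hv h1
      have h3 : μ * (μ + 1) = j * (j + 1) := by exact_mod_cast h2
      nlinarith
    subst hμj
    have hvG' : v ∈ G := ⟨hvF, Module.End.mem_eigenspace_iff.2 (hc v hZ hP)⟩
    exact hv (inner_self_eq_zero.1 (hvG v hvG'))
  have hFG : F ≤ G := by
    have h1 := Submodule.sup_orthogonal_inf_of_hasOrthogonalProjection (inf_le_left : G ≤ F)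
    rw [inf_comm Gᗮ, hW, sup_bot_eq] at h1
    exact h1.ge
  intro v hv
  exact Module.End.mem_eigenspace_iff.1 (hFG (Module.End.mem_eigenspace_iff.2 hv)).2

/-- The Casimir eigenspaces `j (j + 1)`, with `j ≥ 0` a weight, span the space. -/
theorem eq_zero_of_forall_mem_orthogonal [FiniteDimensional ℂ E] (h : IsSpinTriple Z P M)
    {S : Set ℝ}
    (hS : ∀ μ : ℝ, 0 ≤ μ → ∀ v, v ≠ 0 → Z v = (μ : ℂ) • v → μ ∈ S) {x : E}
    (hx : ∀ j ∈ S, x ∈ (Module.End.eigenspace (casimir Z P M) ((j * (j + 1) : ℝ) : ℂ))ᗮ) :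
    x = 0 := by
  let W : Submodule ℂ E :=
    ⨅ j ∈ S, (Module.End.eigenspace (casimir Z P M) ((j * (j + 1) : ℝ) : ℂ))ᗮ
  have hmem : ∀ w, w ∈ W ↔
      ∀ j ∈ S, w ∈ (Module.End.eigenspace (casimir Z P M) ((j * (j + 1) : ℝ) : ℂ))ᗮ := by
    simp [W, Submodule.mem_iInf]
  -- The common orthogonal complement is stable under Z and P. A highest-weight vector in it would
  -- also lie in one of the listed eigenspaces.
  have hW : W = ⊥ := by
    by_contra hW
    obtain ⟨v, hvW, hv, μ, hμ, hZ, hP⟩ := h.exists_highest_weight hW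
      (fun w hw => (hmem _).2 fun j hj g hg => by
        rw [← h.symm]
        exact (hmem _).1 hw j hj _ (eigenspace_invariant h.commute_casimir_weight g hg))
      (fun w hw => (hmem _).2 fun j hj g hg => by
        rw [← h.adj']
        exact (hmem _).1 hw j hj _ (eigenspace_invariant h.commute_casimir_lower g hg))
    exact hv (inner_self_eq_zero.1 ((hmem v).1 hvW μ (hS μ hμ v hv hZ) v
      (Module.End.mem_eigenspace_iff.2 (casimir_apply hZ hP))))
  have := (hmem x).2 hx
  rwa [hW, Submodule.mem_bot] at this

end IsSpinTriple

end SpinQubit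

namespace SpinQubit

/-! ### Symmetrized operators are collective -/

variable {n : ℕ}

/-- The algebra generated by the collective operators `∑ᵢ Aᵢ`. -/
def collective (n : ℕ) : Subalgebra ℂ (Op n) := Algebra.adjoin ℂ (Set.range (total n))

/-- The operator-valued functions of `l` distinct qubits generated by operators on these qubits. -/
def placed (n l : ℕ) : Subalgebra ℂ ((Fin l ↪ Fin n) → Op n) :=
  Algebra.adjoin ℂ {f | ∃ (k : Fin l) (A : Matrix (Fin 2) (Fin 2) ℂ), f = fun e => site (e k) A}

theorem site_mem_placed {l : ℕ} (k : Fin l) (A : Matrix (Fin 2) (Fin 2) ℂ) :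
    (fun e : Fin l ↪ Fin n => site (e k) A) ∈ placed n l :=
  Algebra.subset_adjoin ⟨k, A, rfl⟩

theorem commute_site_of_mem_placed {l : ℕ} {f : (Fin l ↪ Fin n) → Op n} (hf : f ∈ placed n l)
    (e : Fin l ↪ Fin n) {a : Fin n} (ha : a ∉ Set.range e) (A : Matrix (Fin 2) (Fin 2) ℂ) :
    Commute (f e) (site a A) := by
  induction hf using Algebra.adjoin_induction with
  | mem f hf =>
    obtain ⟨k, B, rfl⟩ := hf
    exact commute_site (fun h => ha ⟨k, h⟩) _ _
  | algebraMap r => exact Algebra.commutes r _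
  | add f g _ _ hf hg => exact hf.add_left hg
  | mul f g _ _ hf hg => exact hf.mul_left hg

/-- Operators at position 0 commute past those at the other positions, so a factor at position 0 can
be split off on the right. This prepares an induction on l. -/
theorem placed_succ {l : ℕ} {f : (Fin (l + 1) ↪ Fin n) → Op n} (hf : f ∈ placed n (l + 1)) :
    f ∈ Submodule.span ℂ {f : (Fin (l + 1) ↪ Fin n) → Op n |
      ∃ g ∈ placed n l, ∃ A : Matrix (Fin 2) (Fin 2) ℂ,
        f = fun e => g ((Fin.succEmb l).trans e) * site (e 0) A} := by
  set S := {f : (Fin (l + 1) ↪ Fin n) → Op n |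
      ∃ g ∈ placed n l, ∃ A : Matrix (Fin 2) (Fin 2) ℂ,
        f = fun e => g ((Fin.succEmb l).trans e) * site (e 0) A} with hS
  have h1 : (1 : (Fin (l + 1) ↪ Fin n) → Op n) ∈ Submodule.span ℂ S :=
    Submodule.subset_span ⟨1, one_mem _, 1, by ext1 e; simp [site_one]⟩
  -- Stability of the span under left multiplication is the form that survives products of
  -- generators.
  suffices h : ∀ s ∈ Submodule.span ℂ S, f * s ∈ Submodule.span ℂ S by
    simpa using h 1 h1
  induction hf using Algebra.adjoin_induction with
  | mem f hf =>
    intro s hs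
    refine (Submodule.span_le (p := (Submodule.span ℂ S).comap (LinearMap.mulLeft ℂ f))).2 ?_ hs
    rintro _ ⟨g, hg, A, rfl⟩
    refine Submodule.subset_span ?_
    obtain ⟨k, B, rfl⟩ := hf
    refine Fin.cases ?_ (fun k => ?_) k
    · refine ⟨g, hg, B * A, ?_⟩
      ext1 e
      have : Commute (g ((Fin.succEmb l).trans e)) (site (e 0) B) := by
        refine commute_site_of_mem_placed hg _ ?_ B
        rintro ⟨k, hk⟩
        exact Fin.succ_ne_zero k (e.injective hk)
      simp only [LinearMap.mulLeft_apply, Pi.mul_apply]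
      rw [← mul_assoc, ← this.eq, mul_assoc, site_mul_site]
    · refine ⟨(fun e => site (e k) B) * g, mul_mem (site_mem_placed k B) hg, A, ?_⟩
      ext1 e
      simp [mul_assoc]
  | algebraMap r =>
    intro s hs
    rw [← Algebra.smul_def]
    exact Submodule.smul_mem _ r hs
  | add f g _ _ hf hg =>
    intro s hs
    rw [add_mul]
    exact Submodule.add_mem _ (hf s hs) (hg s hs)
  | mul f g _ _ hf hg =>
    intro s hs
    rw [mul_assoc]
    exact hf _ (hg s hs)

theorem sum_not_mem_range {l : ℕ} (e : Fin l ↪ Fin n) [Fintype {i // i ∉ Set.range e}]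
    (f : Fin n → Op n) :
    ∑ i : {i // i ∉ Set.range e}, f i = ∑ i, f i - ∑ k, f (e k) := by
  classical
  rw [eq_sub_iff_add_eq, ← Finset.sum_map Finset.univ e f,
    ← Finset.sum_subtype (Finset.univ.map e)ᶜ (by simp) f, Finset.sum_compl_add_sum]

/-- Inclusion–exclusion on the split-off qubit: its sum over qubits distinct from the other l is the
full sum, a collective operator, minus the coincidences, which are again functions of l distinct
qubits. -/
theorem sum_mem_collective (l : ℕ) : ∀ f ∈ placed n l, ∑ e, f e ∈ collective n := by
  induction l with
  | zero =>
    intro f hf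
    have : {f : (Fin 0 ↪ Fin n) → Op n | ∃ (k : Fin 0) (A : Matrix (Fin 2) (Fin 2) ℂ),
        f = fun e => site (e k) A} = ∅ := by
      ext f
      simp
    rw [placed, this, Algebra.adjoin_empty, Algebra.mem_bot] at hf
    obtain ⟨c, rfl⟩ := hf
    exact Subalgebra.sum_mem _ fun e _ => (collective n).algebraMap_mem c
  | succ l ih =>
    intro f hf
    have h := placed_succ hf
    clear hf
    induction h using Submodule.span_induction with
    | zero => simp
    | add f g _ _ hf hg =>
      simp only [Pi.add_apply, Finset.sum_add_distrib]
      exact add_mem hf hg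
    | smul c f _ hf =>
      simp only [Pi.smul_apply, ← Finset.smul_sum]
      exact (collective n).smul_mem hf c
    | mem f hf =>
      obtain ⟨g, hg, A, rfl⟩ := hf
      have h1 : ∑ e : Fin (l + 1) ↪ Fin n, g ((Fin.succEmb l).trans e) * site (e 0) A
          = ∑ e : Fin l ↪ Fin n, (g e * total n A - ∑ k, g e * site (e k) A) := by
        rw [Fintype.sum_equiv (Equiv.embeddingFinSucc l (Fin n))
          (fun e => g ((Fin.succEmb l).trans e) * site (e 0) A) (fun p => g p.1 * site p.2.1 A),
          Fintype.sum_sigma]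
        · refine Finset.sum_congr rfl fun e _ => ?_
          change ∑ y : {i // i ∉ Set.range e}, g e * site y.1 A = _
          rw [← Finset.mul_sum, sum_not_mem_range e (fun i => site i A), mul_sub, total_apply,
            Finset.mul_sum, Finset.mul_sum]
        · intro e
          rfl
      rw [h1, Finset.sum_sub_distrib, ← Finset.sum_mul, Finset.sum_comm]
      refine sub_mem (mul_mem (ih g hg) (Algebra.subset_adjoin ⟨A, rfl⟩)) (sum_mem fun k _ => ?_)
      exact ih _ (mul_mem hg (site_mem_placed k A))

/-- The summands of `bodyOp`. -/
noncomputable def pairing {l : ℕ} (i : Fin l ↪ Fin n) : Op n :=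
  (List.ofFn fun r : Fin (l / 2) =>
    exchange (i ⟨2 * r, by omega⟩) (i ⟨2 * r + 1, by omega⟩)).prod

theorem bodyOp_eq (l : ℕ) :
    bodyOp n l = (1 / (Nat.factorial (l / 2) : ℂ)) • ∑ i : Fin l ↪ Fin n, pairing i := rfl

theorem pairing_mem_placed (l : ℕ) : (pairing : (Fin l ↪ Fin n) → Op n) ∈ placed n l := by
  have : (pairing : (Fin l ↪ Fin n) → Op n) = (List.ofFn fun r : Fin (l / 2) =>
      fun i : Fin l ↪ Fin n => (exchange (i ⟨2 * r, by omega⟩) (i ⟨2 * r + 1, by omega⟩))).prod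
      := by
    ext1 i
    rw [Pi.list_prod_apply, List.map_ofFn]
    rfl
  rw [this]
  refine Subalgebra.list_prod_mem _ fun f hf => ?_
  rw [List.mem_ofFn] at hf
  obtain ⟨r, rfl⟩ := hf
  have : (fun i : Fin l ↪ Fin n => exchange (i ⟨2 * r, by omega⟩) (i ⟨2 * r + 1, by omega⟩))
      = (1 / 2 : ℂ) • ∑ v, (fun i : Fin l ↪ Fin n => site (i ⟨2 * r, by omega⟩) (pauli v))
        * fun i : Fin l ↪ Fin n => site (i ⟨2 * r + 1, by omega⟩) (pauli v) := by
    ext1 i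
    simp [exchange]
  rw [this]
  exact Subalgebra.smul_mem _ (sum_mem fun v _ =>
    mul_mem (site_mem_placed _ _) (site_mem_placed _ _)) _

theorem bodyOp_mem_collective (l : ℕ) : bodyOp n l ∈ collective n :=
  Subalgebra.smul_mem _ (sum_mem_collective l _ (pairing_mem_placed l)) _

theorem exchange_pair_ne {l : ℕ} (i : Fin l ↪ Fin n) (r : Fin (l / 2)) :
    i ⟨2 * r, by omega⟩ ≠ i ⟨2 * r + 1, by omega⟩ := by
  intro h
  have := i.injective h
  simp at this

theorem bodyOp_isRotInvariant (l : ℕ) : IsRotInvariant (bodyOp n l) := by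
  intro U _
  refine Commute.smul_left (Commute.sum_left _ _ _ fun i _ => ?_) _
  refine Commute.list_prod_left _ _ fun A hA => ?_
  rw [List.mem_ofFn] at hA
  obtain ⟨r, rfl⟩ := hA
  exact commute_exchange_tensorOp (exchange_pair_ne i r) U

theorem collective_eq : collective n = Algebra.adjoin ℂ {weightOp n, raising n, lowering n} := by
  refine le_antisymm (Algebra.adjoin_le ?_) (Algebra.adjoin_mono ?_)
  · rintro _ ⟨A, rfl⟩
    have : A = ((A 0 0 + A 1 1) / 2) • (1 : Matrix (Fin 2) (Fin 2) ℂ)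
        + (A 0 0 - A 1 1) • ((1 / 2 : ℂ) • !![1, 0; 0, -1]) + A 0 1 • !![0, 1; 0, 0]
        + A 1 0 • !![0, 0; 1, 0] := by
      ext i j
      fin_cases i <;> fin_cases j <;> simp <;> ring
    rw [this]
    rw [map_add, map_add, map_add, map_smul, map_smul (total n) (A 0 0 - A 1 1),
      map_smul (total n) (A 0 1), map_smul (total n) (A 1 0), total_one]
    have hw : weightOp n ∈ Algebra.adjoin ℂ {weightOp n, raising n, lowering n} :=
      Algebra.subset_adjoin (by simp)
    have hr : raising n ∈ Algebra.adjoin ℂ {weightOp n, raising n, lowering n} :=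
      Algebra.subset_adjoin (by simp)
    have hl : lowering n ∈ Algebra.adjoin ℂ {weightOp n, raising n, lowering n} :=
      Algebra.subset_adjoin (by simp)
    exact add_mem (add_mem (add_mem (Subalgebra.smul_mem _ (Subalgebra.smul_mem _ (one_mem _) _) _)
      (Subalgebra.smul_mem _ hw _)) (Subalgebra.smul_mem _ hr _)) (Subalgebra.smul_mem _ hl _)
  · rintro _ (rfl | rfl | rfl) <;> exact ⟨_, rfl⟩

end SpinQubit

namespace SpinQubit

/-! ### Integrality of the eigenvalues of `C_l` -/

variable {n : ℕ}

/-- For a free action every orbit has |Γ| points and F is constant on it, so z is the sum of F over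
orbit representatives. -/
theorem exists_sum_eq_card_smul {Γ X M : Type*} [Group Γ] [Finite Γ] [Fintype X] [AddCommGroup M]
    (α : Γ →* Equiv.Perm X) (hα : ∀ g x, α g x = x → g = 1) {F : X → M}
    (hF : ∀ g x, F (α g x) = F x) (Z : AddSubgroup M) (hZ : ∀ x, F x ∈ Z) :
    ∃ z ∈ Z, ∑ x, F x = Nat.card Γ • z := by
  classical
  have := Fintype.ofFinite Γ
  let _ : MulAction Γ X := MulAction.compHom X α
  have hsmul : ∀ (g : Γ) (x : X), g • x = α g x := fun _ _ => rfl
  let _ := MulAction.orbitRel Γ X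
  refine ⟨∑ ω : Quotient (MulAction.orbitRel Γ X), F ω.out, sum_mem fun _ _ => hZ _, ?_⟩
  rw [← Finset.sum_fiberwise Finset.univ
    (fun x => (Quotient.mk _ x : Quotient (MulAction.orbitRel Γ X))) F, Finset.smul_sum]
  refine Finset.sum_congr rfl fun ω _ => ?_
  have hfib : Finset.univ.filter (fun x => (Quotient.mk _ x : Quotient (MulAction.orbitRel Γ X))
      = ω)
      = Finset.univ.image fun g : Γ => g • ω.out := by
    ext x
    simp only [Finset.mem_filter, Finset.mem_univ, true_and, Finset.mem_image]
    conv_lhs => rw [← Quotient.out_eq ω, Quotient.eq]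
    exact MulAction.orbitRel_apply
  have hinj : Function.Injective fun g : Γ => g • ω.out := by
    intro g h hgh
    have : α (h⁻¹ * g) ω.out = ω.out := by
      rw [← hsmul, mul_smul]
      simp only at hgh
      rw [hgh, inv_smul_smul]
    exact (inv_mul_eq_one.1 (hα _ _ this)).symm
  have hconst : ∀ g : Γ, F (g • ω.out) = F ω.out := fun g => hF g _
  rw [hfib, Finset.sum_image hinj.injOn, Finset.sum_congr rfl fun g _ => hconst g,
    Finset.sum_const, Finset.card_univ, Nat.card_eq_fintype_card]

/-- The action of a permutation of the labels on tuples of distinct qubits. -/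
def relabel (n l : ℕ) : Equiv.Perm (Fin l) →* Equiv.Perm (Fin l ↪ Fin n) :=
  MonoidHom.mk' (fun g => Equiv.embeddingCongr g (Equiv.refl _)) fun g h => by
    ext e k
    rfl

theorem relabel_apply {l : ℕ} (g : Equiv.Perm (Fin l)) (e : Fin l ↪ Fin n) (k : Fin l) :
    relabel n l g e k = e (g⁻¹ k) := rfl

/-- Flips inside the pairs. -/
def flips (m : ℕ) : (Fin m → Equiv.Perm (Fin 2)) →* Equiv.Perm (Fin m × Fin 2) where
  toFun f := Equiv.prodShear (Equiv.refl _) f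
  map_one' := by ext x <;> rfl
  map_mul' f g := by ext x <;> rfl

/-- Permutations of the pairs. -/
def shuffles (m : ℕ) : Equiv.Perm (Fin m) →* Equiv.Perm (Fin m × Fin 2) where
  toFun π := Equiv.prodCongr π (Equiv.refl _)
  map_one' := by ext x <;> rfl
  map_mul' f g := by ext x <;> rfl

/-- The symmetry group of `m` unordered pairs. -/
abbrev PairGroup (m : ℕ) : Type :=
  (Fin m → Equiv.Perm (Fin 2)) ⋊[mulAutArrow] Equiv.Perm (Fin m)

/-- The permutations of `m` ordered pairs that preserve the underlying unordered pairs. -/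
def pairPerm (m : ℕ) : PairGroup m →* Equiv.Perm (Fin m × Fin 2) :=
  SemidirectProduct.lift (flips m) (shuffles m) fun π => by
    ext f x
    · simp [flips, shuffles]
    · simp [flips, shuffles]
      rfl

theorem pairPerm_apply {m : ℕ} (g : PairGroup m) (x : Fin m × Fin 2) :
    pairPerm m g x = (g.right x.1, g.left (g.right x.1) x.2) := rfl

theorem pairPerm_injective (m : ℕ) : Function.Injective (pairPerm m) := by
  rw [injective_iff_map_eq_one]
  intro g hg
  have h1 : g.right = 1 := by
    ext k
    have := congrArg Prod.fst (Equiv.congr_fun hg (k, 0))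
    rw [pairPerm_apply] at this
    exact congrArg Fin.val this
  refine SemidirectProduct.ext ?_ h1
  ext k b
  have := congrArg Prod.snd (Equiv.congr_fun hg (k, b))
  rw [pairPerm_apply, h1] at this
  exact congrArg Fin.val this

/-- The positions of the members of the pairs in `0, 1, …, l - 1`. -/
def pairPos (l : ℕ) : Fin (l / 2) × Fin 2 ↪ Fin l where
  toFun x := ⟨2 * x.1 + x.2, by omega⟩
  inj' x y h := by
    simp only [Fin.mk.injEq] at h
    ext <;> omega

/-- The action of the symmetry group of the pairs on tuples of distinct qubits. -/
noncomputable def pairAction (n l : ℕ) : PairGroup (l / 2) →* Equiv.Perm (Fin l ↪ Fin n) :=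
  ((relabel n l).comp (Equiv.Perm.viaEmbeddingHom (pairPos l))).comp (pairPerm (l / 2))

theorem pairAction_apply {l : ℕ} (g : PairGroup (l / 2)) (e : Fin l ↪ Fin n)
    (x : Fin (l / 2) × Fin 2) :
    pairAction n l g e (pairPos l x) = e (pairPos l (pairPerm _ g⁻¹ x)) := by
  rw [pairAction, MonoidHom.comp_apply, MonoidHom.comp_apply, relabel_apply, ← map_inv, ← map_inv,
    Equiv.Perm.viaEmbeddingHom_apply, Equiv.Perm.viaEmbedding_apply]

theorem pairAction_free {l : ℕ} (g : PairGroup (l / 2)) (e : Fin l ↪ Fin n)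
    (h : pairAction n l g e = e) : g = 1 := by
  rw [← inv_eq_one]
  refine pairPerm_injective _ ?_
  ext1 x
  rw [map_one, Equiv.Perm.one_apply]
  refine (pairPos l).injective (e.injective ?_)
  rw [← pairAction_apply, h]

instance (m : ℕ) : Finite (PairGroup m) := Finite.of_equiv _ SemidirectProduct.equivProd.symm

theorem card_pairGroup (m : ℕ) : Nat.card (PairGroup m) = 2 ^ m * m.factorial := by
  rw [SemidirectProduct.card]
  simp [Fintype.card_perm]

/-! ### Invariance of the pairings and integrality of `C_l`. -/

theorem exchange_comm (r s : Fin n) : exchange r s = exchange s r := by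
  rcases eq_or_ne r s with rfl | h
  · rfl
  · rw [exchange_eq h, exchange_eq h.symm, Equiv.swap_comm]

theorem commute_exchange_site {r s a : Fin n} (hr : r ≠ a) (hs : s ≠ a)
    (A : Matrix (Fin 2) (Fin 2) ℂ) : Commute (exchange r s) (site a A) :=
  (Commute.sum_left _ _ _ fun _ _ => (commute_site hr _ _).mul_left (commute_site hs _ _))
    |>.smul_left _

theorem commute_exchange {r s a b : Fin n} (hra : r ≠ a) (hsa : s ≠ a) (hrb : r ≠ b) (hsb : s ≠ b) :
    Commute (exchange r s) (exchange a b) :=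
  (Commute.sum_right _ _ _ fun _ _ => (commute_exchange_site hra hsa _).mul_right
    (commute_exchange_site hrb hsb _)).smul_right _

/-- The exchange interaction of a pair. -/
noncomputable def pairExchange {l : ℕ} (i : Fin l ↪ Fin n) (r : Fin (l / 2)) : Op n :=
  exchange (i (pairPos l (r, 0))) (i (pairPos l (r, 1)))

theorem pairing_eq {l : ℕ} (i : Fin l ↪ Fin n) : pairing i = (List.ofFn (pairExchange i)).prod :=
    rfl

theorem commute_pairExchange {l : ℕ} (i : Fin l ↪ Fin n) (r s : Fin (l / 2)) :
    Commute (pairExchange i r) (pairExchange i s) := by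
  rcases eq_or_ne r s with rfl | h
  · rfl
  · refine commute_exchange ?_ ?_ ?_ ?_ <;> simp [h]

theorem pairExchange_pairAction {l : ℕ} (g : PairGroup (l / 2)) (i : Fin l ↪ Fin n)
    (r : Fin (l / 2)) :
    pairExchange (pairAction n l g i) r = pairExchange i ((g⁻¹).right r) := by
  rw [pairExchange, pairAction_apply, pairAction_apply, pairPerm_apply, pairPerm_apply,
    pairExchange]
  generalize (g⁻¹).left ((g⁻¹).right r) = σ
  dsimp only
  have h : σ = 1 ∨ σ = Equiv.swap 0 1 := by
    revert σ
    decide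
  rcases h with rfl | rfl
  · rfl
  · rw [Equiv.swap_apply_left, Equiv.swap_apply_right, exchange_comm]

/-- Flips are invisible because R_{rs} = R_{sr}, and shuffles because exchanges of disjoint pairs
commute. -/
theorem pairing_pairAction {l : ℕ} (g : PairGroup (l / 2)) (i : Fin l ↪ Fin n) :
    pairing (pairAction n l g i) = pairing i := by
  have h : pairExchange (pairAction n l g i) = pairExchange i ∘ (g⁻¹).right :=
    funext fun r => pairExchange_pairAction g i r
  rw [pairing_eq, pairing_eq, h]
  refine (Equiv.Perm.ofFn_comp_perm _ _).prod_eq' ?_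
  rw [List.pairwise_ofFn]
  exact fun r s _ => commute_pairExchange i _ _

/-- Matrices with integer entries. -/
def integerOps (n : ℕ) : Subring (Op n) := ((Int.castRingHom ℂ).mapMatrix : _ →+* Op n).range

theorem two_smul_exchange_mem {r s : Fin n} (h : r ≠ s) :
    (2 : ℂ) • exchange r s ∈ integerOps n := by
  have h1 : permOp (Equiv.swap r s) ∈ integerOps n := by
    refine ⟨Matrix.of fun x y => if x ∘ Equiv.swap r s = y then 1 else 0, ?_⟩
    ext x y
    simp [permOp]
  have : (2 : ℂ) • exchange r s = 2 * permOp (Equiv.swap r s) - 1 := by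
    rw [exchange_eq h, smul_sub, smul_smul, two_smul, two_mul (permOp _)]
    norm_num
  rw [this]
  exact sub_mem (mul_mem (ofNat_mem _ 2) h1) (one_mem _)

theorem list_prod_map_smul {R A : Type*} [CommSemiring R] [Semiring A] [Algebra R A] (c : R)
    (L : List A) : (L.map fun a => c • a).prod = c ^ L.length • L.prod := by
  induction L with
  | nil => simp
  | cons a L ih => rw [List.map_cons, List.prod_cons, ih, smul_mul_smul_comm, List.length_cons,
      pow_succ',
    List.prod_cons]

theorem two_pow_smul_pairing_mem {l : ℕ} (i : Fin l ↪ Fin n) :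
    (2 : ℂ) ^ (l / 2) • pairing i ∈ integerOps n := by
  have := list_prod_map_smul (2 : ℂ) (List.ofFn (pairExchange i))
  rw [List.length_ofFn] at this
  rw [pairing_eq, ← this, List.map_ofFn]
  refine Subring.list_prod_mem _ fun A hA => ?_
  rw [List.mem_ofFn] at hA
  obtain ⟨r, rfl⟩ := hA
  exact two_smul_exchange_mem (exchange_pair_ne i r)

/-- With m = l/2, each pairing times 2^m is integral. The pair group of order 2^m m! acts freely on
tuples, so the sum of these is 2^m m! times an integral matrix, which compensates exactly both 2^m
and the m! in `C_l`. -/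
theorem bodyOp_mem_integerOps (n l : ℕ) : bodyOp n l ∈ integerOps n := by
  obtain ⟨z, hz, h⟩ := exists_sum_eq_card_smul (pairAction n l) pairAction_free
    (F := fun i => (2 : ℂ) ^ (l / 2) • pairing i)
    (fun g i => by rw [pairing_pairAction]) (integerOps n).toAddSubgroup
    two_pow_smul_pairing_mem
  suffices h' : bodyOp n l = z by
    rw [h']
    exact hz
  rw [bodyOp_eq]
  rw [card_pairGroup, ← Finset.smul_sum, ← Nat.cast_smul_eq_nsmul ℂ] at h
  push_cast at h
  rw [mul_smul] at h
  have h2 := smul_right_injective (Op n) (pow_ne_zero (l / 2) (two_ne_zero (α := ℂ))) h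
  rw [h2, smul_smul, one_div, inv_mul_cancel₀, one_smul]
  exact_mod_cast (l / 2).factorial_ne_zero

/-- The entries of `J²` are rational. -/
theorem exists_angMomSq_eq_map (n : ℕ) :
    ∃ B : Matrix (Bits n) (Bits n) ℚ, angMomSq n = B.map (algebraMap ℚ ℂ) := by
  let R : Subalgebra ℚ (Op n) := (Algebra.ofId ℚ ℂ).mapMatrix.range
  suffices h : angMomSq n ∈ R by
    obtain ⟨B, hB⟩ := h
    exact ⟨B, hB.symm⟩
  have hq : ∀ (q : ℚ) (A : Op n), A ∈ R → (q : ℂ) • A ∈ R := by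
    intro q A hA
    have : (q : ℂ) • A = q • A := by
      ext x y
      simp [Algebra.smul_def]
    rw [this]
    exact R.smul_mem hA q
  have hex : ∀ r s : Fin n, r ≠ s → exchange r s ∈ R := by
    intro r s hrs
    rw [exchange_eq hrs]
    refine sub_mem ⟨Matrix.of fun x y => if x ∘ Equiv.swap r s = y then 1 else 0, ?_⟩ ?_
    · ext x y
      simp [permOp, apply_ite (Algebra.ofId ℚ ℂ)]
    · simpa using hq (1 / 2) 1 (one_mem _)
  rw [angMomSq_eq_exchange]
  refine add_mem ?_ ?_
  · simpa using hq (3 * n / 4) 1 (one_mem _)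
  · have : ∑ r, ∑ s ∈ Finset.univ.erase r, exchange r s ∈ R :=
      sum_mem fun r _ => sum_mem fun s hs => hex r s (Finset.ne_of_mem_erase hs).symm
    simpa using hq (1 / 2) _ this

/-- Singularity of B is visible in its rational determinant, so its kernel contains a nonzero
rational vector. Its A-eigenvalue c is then rational and a root of a monic integer polynomial, hence
an integer. -/
theorem exists_int_eq_of_eigenvalue {ι : Type*} [Fintype ι] [DecidableEq ι] (A : Matrix ι ι ℤ)
    (B : Matrix ι ι ℚ) {c : ℂ} {v : ι → ℂ} (hv : v ≠ 0)
    (hB : (B.map (algebraMap ℚ ℂ)).mulVec v = 0)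
    (h : ∀ w, (B.map (algebraMap ℚ ℂ)).mulVec w = 0 → (A.map (Int.cast : ℤ → ℂ)).mulVec w = c • w) :
    ∃ z : ℤ, c = z := by
  have hdet : B.det = 0 := by
    have h1 := Matrix.exists_mulVec_eq_zero_iff.1 ⟨v, hv, hB⟩
    have h2 : (B.map (algebraMap ℚ ℂ)).det = algebraMap ℚ ℂ B.det :=
      (RingHom.map_det (algebraMap ℚ ℂ) B).symm
    rw [h2] at h1
    exact (map_eq_zero _).1 h1
  obtain ⟨w, hw, hBw⟩ := Matrix.exists_mulVec_eq_zero_iff.2 hdet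
  let AQ : Matrix ι ι ℚ := A.map (Int.cast : ℤ → ℚ)
  have hcast : ∀ x, ((AQ.mulVec w x : ℚ) : ℂ) = c * w x := by
    intro x
    have h1 : (B.map (algebraMap ℚ ℂ)).mulVec (algebraMap ℚ ℂ ∘ w) = 0 := by
      ext y
      rw [← RingHom.map_mulVec, hBw]
      simp
    have h2 := congrFun (h _ h1) x
    have h3 : A.map (Int.cast : ℤ → ℂ) = AQ.map (algebraMap ℚ ℂ) := by
      ext
      simp [AQ]
    rw [h3, ← RingHom.map_mulVec] at h2
    simpa using h2
  obtain ⟨x, hx⟩ := Function.ne_iff.1 hw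
  have hx' : ((w x : ℚ) : ℂ) ≠ 0 := by exact_mod_cast hx
  set q : ℚ := AQ.mulVec w x / w x with hq
  have hc : c = q := by
    rw [hq]
    push_cast
    rw [hcast, mul_div_cancel_right₀ _ hx']
  have hAw : AQ.mulVec w = q • w := by
    ext y
    have := hcast y
    rw [hc] at this
    exact_mod_cast this
  have hint : IsIntegral ℤ q := by
    refine ⟨A.charpoly, A.charpoly_monic, ?_⟩
    rw [← Polynomial.eval_map]
    have h1 : A.charpoly.map (algebraMap ℤ ℚ) = AQ.charpoly :=
      (Matrix.charpoly_map A (algebraMap ℤ ℚ)).symm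
    rw [h1, Matrix.eval_charpoly]
    refine Matrix.exists_mulVec_eq_zero_iff.1 ⟨w, hw, ?_⟩
    rw [Matrix.sub_mulVec, hAw, Matrix.scalar_apply, Matrix.diagonal_const_mulVec, sub_self]
  obtain ⟨z, hz⟩ := IsIntegrallyClosed.isIntegral_iff.1 hint
  refine ⟨z, ?_⟩
  rw [hc, ← hz]
  simp

end SpinQubit

namespace SpinQubit

/-! ### Traces against `C_l` -/

variable {n : ℕ}

/-- The term w = v gives σ_v and each of the two anticommuting terms gives -σ_v. -/
theorem sum_pauli_conj_pauli (v : Fin 3) : ∑ w, pauli w * pauli v * pauli w = -pauli v := by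
  ext i j
  fin_cases v <;> fin_cases i <;> fin_cases j <;> simp [pauli, Fin.sum_univ_three]

theorem sum_pauli_conj_exchange {a b : Fin n} (h : a ≠ b) :
    ∑ w, site a (pauli w) * exchange a b * site a (pauli w) = -exchange a b := by
  have h1 : ∀ w v, site a (pauli w) * (site a (pauli v) * site b (pauli v)) * site a (pauli w)
      = site a (pauli w * pauli v * pauli w) * site b (pauli v) := by
    intro w v
    rw [mul_assoc, mul_assoc, ← (commute_site h (pauli w) (pauli v)).eq, ← mul_assoc, ← mul_assoc,
      site_mul_site, site_mul_site, mul_assoc]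
  simp only [exchange, mul_smul_comm, smul_mul_assoc, Finset.mul_sum, Finset.sum_mul, h1]
  rw [← Finset.smul_sum, Finset.sum_comm, ← smul_neg, ← Finset.sum_neg_distrib]
  congr 1
  refine Finset.sum_congr rfl fun v _ => ?_
  rw [← Finset.sum_mul, ← neg_mul]
  congr 1
  simp only [← siteLin_apply]
  rw [← map_sum, sum_pauli_conj_pauli, map_neg]

/-- Conjugating Q by a Pauli matrix that commutes with A does not change Tr(QA). Summing the three
conjugates gives 3 Tr(QA) = -Tr(QA). -/
theorem trace_mul_eq_zero_of_sum_conj {a : Fin n} {Q A : Op n}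
    (hQ : ∑ w, site a (pauli w) * Q * site a (pauli w) = -Q)
    (hA : ∀ w, Commute A (site a (pauli w))) : (Q * A).trace = 0 := by
  have h1 : ∀ w, (site a (pauli w) * Q * site a (pauli w) * A).trace = (Q * A).trace := by
    intro w
    rw [mul_assoc, ← (hA w).eq, Matrix.trace_mul_comm, mul_assoc,
      ← mul_assoc (site a (pauli w)) (site a (pauli w)) Q,
      site_mul_site, pauli_mul_self, site_one, one_mul, Matrix.trace_mul_comm]
  have h2 : ((∑ w, site a (pauli w) * Q * site a (pauli w)) * A).trace = 3 * (Q * A).trace := by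
    rw [Finset.sum_mul, Matrix.trace_sum, Finset.sum_congr rfl fun w _ => h1 w]
    simp
  rw [hQ, neg_mul, Matrix.trace_neg] at h2
  linear_combination (-1 / 4 : ℂ) * h2

theorem List.sum_conj_prod_ofFn {R : Type*} [Ring R] {m : ℕ} (f : Fin m → R) {ι : Type*}
    (s : Finset ι) (g : ι → R) (r : Fin m) (hr : ∑ w ∈ s, g w * f r * g w = -f r)
    (hc : ∀ r', r' ≠ r → ∀ w, Commute (f r') (g w)) :
    ∑ w ∈ s, g w * (List.ofFn f).prod * g w = -(List.ofFn f).prod := by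
  induction m with
  | zero => exact r.elim0
  | succ m ih =>
    rw [List.ofFn_succ, List.prod_cons]
    refine Fin.cases (fun hr hc => ?_) (fun r hr hc => ?_) r hr hc
    · have h1 : ∀ w, Commute (List.ofFn fun i : Fin m => f i.succ).prod (g w) := by
        intro w
        refine Commute.list_prod_left _ _ fun A hA => ?_
        rw [List.mem_ofFn] at hA
        obtain ⟨r', rfl⟩ := hA
        exact hc _ (Fin.succ_ne_zero r') w
      rw [← neg_mul, ← hr, Finset.sum_mul]
      refine Finset.sum_congr rfl fun w _ => ?_
      rw [mul_assoc, mul_assoc, (h1 w).eq]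
      simp only [mul_assoc]
    · have h1 := ih (fun i => f i.succ) r hr
        (fun r' hr' w => hc _ (fun h => hr' (Fin.succ_injective _ h)) w)
      rw [← mul_neg, ← h1, Finset.mul_sum]
      refine Finset.sum_congr rfl fun w _ => ?_
      rw [← mul_assoc, ← (hc 0 (Fin.succ_ne_zero r).symm w).eq]
      simp only [mul_assoc]

theorem exists_eq_pairPos {l : ℕ} (hl : Even l) (k : Fin l) : ∃ x, k = pairPos l x := by
  obtain ⟨m, rfl⟩ := hl
  refine ⟨(⟨k / 2, by omega⟩, ⟨k % 2, by omega⟩), Fin.ext ?_⟩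
  change (k : ℕ) = 2 * (k / 2) + k % 2
  omega

theorem sum_pauli_conj_pairing {l : ℕ} (hl : Even l) (i : Fin l ↪ Fin n) {a : Fin n}
    (ha : a ∈ Set.range i) :
    ∑ w, site a (pauli w) * pairing i * site a (pauli w) = -pairing i := by
  obtain ⟨k, rfl⟩ := ha
  obtain ⟨⟨r, b⟩, rfl⟩ := exists_eq_pairPos hl k
  rw [pairing_eq]
  refine List.sum_conj_prod_ofFn _ _ _ r ?_ fun r' hr' w => ?_
  · have hne : i (pairPos l (r, 0)) ≠ i (pairPos l (r, 1)) := by simp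
    have hb : b = 0 ∨ b = 1 := by omega
    rcases hb with rfl | rfl
    · exact sum_pauli_conj_exchange hne
    · rw [pairExchange, exchange_comm]
      exact sum_pauli_conj_exchange hne.symm
  · refine commute_exchange_site ?_ ?_ _ <;> simp [hr']

/-- `C_l` has vanishing trace against operators acting on fewer than `l` qubits. -/
theorem trace_bodyOp_mul_eq_zero {l : ℕ} (hl : Even l) {A : Op n} {S : Finset (Fin n)}
    (hS : S.card < l) (hA : ∀ a, a ∉ S → ∀ w, Commute A (site a (pauli w))) :
    (bodyOp n l * A).trace = 0 := by
  rw [bodyOp_eq, smul_mul_assoc, Matrix.trace_smul, Finset.sum_mul, Matrix.trace_sum,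
    Finset.sum_eq_zero, smul_zero]
  intro i _
  obtain ⟨k, hk⟩ : ∃ k, i k ∉ S := by
    by_contra! h
    have h1 := Finset.card_le_card_of_injOn i (s := Finset.univ) (t := S) (fun k _ => h k)
      i.injective.injOn
    rw [Finset.card_univ, Fintype.card_fin] at h1
    omega
  exact trace_mul_eq_zero_of_sum_conj (sum_pauli_conj_pairing hl i ⟨k, rfl⟩) (hA _ hk)

/-! ### Adding an ancilla -/

theorem sum_bits_succ {M : Type*} [AddCommMonoid M] (f : Bits (n + 1) → M) :
    ∑ x, f x = ∑ x : Bits n, ∑ b : Fin 2, f (Fin.snoc (α := fun _ => Fin 2) x b) := by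
  rw [← Fintype.sum_prod_type' (f := fun (x : Bits n) (b : Fin 2) =>
    f (Fin.snoc (α := fun _ => Fin 2) x b))]
  exact (Fintype.sum_equiv ((Equiv.prodComm _ _).trans (Fin.snocEquiv fun _ => Fin 2)) _ _
    fun x => rfl).symm

theorem forall_bits_succ {p : Bits (n + 1) → Prop} :
    (∀ x, p x) ↔ ∀ (x : Bits n) (b : Fin 2), p (Fin.snoc (α := fun _ => Fin 2) x b) :=
  ⟨fun h _ _ => h _, fun h x => by rw [← Fin.snoc_init_self x]; exact h _ _⟩

theorem extendByOne_snoc (A : Op n) (x y : Bits n) (a b : Fin 2) :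
    extendByOne A (Fin.snoc (α := fun _ => Fin 2) x a) (Fin.snoc (α := fun _ => Fin 2) y b)
      = A x y * (1 : Matrix (Fin 2) (Fin 2) ℂ) a b := by
  have h : ∀ (x : Bits n) (a : Fin 2), Fin.snoc (α := fun _ => Fin 2) x a (Fin.last n) = a :=
    fun x a => Fin.snoc_last (α := fun _ => Fin 2) a x
  rw [extendByOne, Matrix.of_apply, Fin.init_snoc, Fin.init_snoc, h, h]

theorem op_ext_snoc {A B : Op (n + 1)} (h : ∀ (x y : Bits n) (a b : Fin 2),
    A (Fin.snoc (α := fun _ => Fin 2) x a) (Fin.snoc (α := fun _ => Fin 2) y b)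
      = B (Fin.snoc (α := fun _ => Fin 2) x a) (Fin.snoc (α := fun _ => Fin 2) y b)) : A = B := by
  ext x y
  rw [← Fin.snoc_init_self x, ← Fin.snoc_init_self y]
  exact h _ _ _ _

/-- `A ↦ A ⊗ I_a` as a homomorphism. -/
def extendHom (n : ℕ) : Op n →ₐ[ℂ] Op (n + 1) :=
  AlgHom.ofLinearMap
    { toFun := extendByOne
      map_add' := fun A B => by
        ext x y
        simp [extendByOne, add_mul]
      map_smul' := fun c A => by
        ext x y
        simp [extendByOne, mul_assoc] }
    (op_ext_snoc fun x y a b => by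
      have : (1 : Op (n + 1)) (Fin.snoc (α := fun _ => Fin 2) x a)
        (Fin.snoc (α := fun _ => Fin 2) y b)
          = (1 : Op n) x y * (1 : Matrix (Fin 2) (Fin 2) ℂ) a b := by
        simp only [Matrix.one_apply, Fin.snoc_inj]
        split_ifs <;> simp_all
      rw [this]
      exact extendByOne_snoc _ _ _ _ _)
    (fun A B => op_ext_snoc fun x y a b => by
      change extendByOne (A * B) _ _ = (extendByOne A * extendByOne B) _ _
      rw [Matrix.mul_apply, sum_bits_succ]
      simp only [extendByOne_snoc, Matrix.mul_apply, Finset.sum_mul, Matrix.one_apply]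
      refine Finset.sum_congr rfl fun z _ => ?_
      rw [Fin.sum_univ_two]
      fin_cases a <;> fin_cases b <;> simp)

theorem extendHom_apply (A : Op n) : extendHom n A = extendByOne A := rfl

theorem extendByOne_site (r : Fin n) (A : Matrix (Fin 2) (Fin 2) ℂ) :
    extendByOne (site r A) = site r.castSucc A := by
  refine op_ext_snoc fun x y a b => ?_
  rw [extendByOne_snoc, site_apply, site_apply, Fin.snoc_castSucc, Fin.snoc_castSucc,
    Matrix.one_apply]
  simp only [Fin.forall_fin_succ', Fin.snoc_castSucc, Fin.snoc_last, ne_eq, Fin.castSucc_inj,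
    (Fin.castSucc_ne_last r).symm, not_false_eq_true, true_imp_iff]
  split_ifs <;> simp_all

theorem site_last_snoc (B : Matrix (Fin 2) (Fin 2) ℂ) (x y : Bits n) (a b : Fin 2) :
    site (Fin.last n) B (Fin.snoc (α := fun _ => Fin 2) x a) (Fin.snoc (α := fun _ => Fin 2) y b)
      = if x = y then B a b else 0 := by
  rw [site_apply, Fin.snoc_last, Fin.snoc_last]
  congr 1
  simp [Fin.forall_fin_succ', funext_iff, Fin.castSucc_ne_last]

theorem commute_extendByOne_site_last (A : Op n) (B : Matrix (Fin 2) (Fin 2) ℂ) :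
    Commute (extendByOne A) (site (Fin.last n) B) := by
  refine op_ext_snoc fun x y a b => ?_
  rw [Matrix.mul_apply, Matrix.mul_apply, sum_bits_succ, sum_bits_succ]
  simp only [extendByOne_snoc, site_last_snoc, Matrix.one_apply]
  simp [mul_comm]

theorem trace_extendByOne (A : Op n) : (extendByOne A).trace = 2 * A.trace := by
  rw [Matrix.trace, sum_bits_succ]
  simp [extendByOne_snoc, Matrix.trace, two_mul, Finset.sum_add_distrib]

theorem extendByOne_conjTranspose (A : Op n) :
    (extendByOne A).conjTranspose = extendByOne A.conjTranspose := by
  refine op_ext_snoc fun x y a b => ?_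
  rw [Matrix.conjTranspose_apply, extendByOne_snoc, extendByOne_snoc, Matrix.conjTranspose_apply]
  fin_cases a <;> fin_cases b <;> simp

theorem total_succ (A : Matrix (Fin 2) (Fin 2) ℂ) :
    total (n + 1) A = extendByOne (total n A) + site (Fin.last n) A := by
  rw [total_apply, Fin.sum_univ_castSucc, total_apply, ← extendHom_apply, map_sum]
  simp [extendHom_apply, extendByOne_site]

theorem commute_extendByOne_total {A : Op n} (hA : ∀ B, Commute A (total n B))
    (B : Matrix (Fin 2) (Fin 2) ℂ) : Commute (extendByOne A) (total (n + 1) B) := by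
  rw [total_succ]
  exact ((hA B).map (extendHom n)).add_right (commute_extendByOne_site_last A B)

theorem extendByOne_exchange (r s : Fin n) :
    extendByOne (exchange r s) = exchange r.castSucc s.castSucc := by
  rw [exchange, exchange, ← extendHom_apply, map_smul, map_sum]
  simp only [map_mul, extendHom_apply, extendByOne_site]

theorem pairing_castSucc {l : ℕ} (i : Fin l ↪ Fin n) :
    pairing (i.trans Fin.castSuccEmb) = extendByOne (pairing i) := by
  rw [pairing_eq, pairing_eq, ← extendHom_apply, map_list_prod, List.map_ofFn]
  congr 2
  ext1 r
  exact (extendByOne_exchange _ _).symm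

/-- Tuples containing the ancilla average to zero over its Pauli matrices; for the remaining ones
the trace over the ancilla gives 2. -/
theorem trace_bodyOp_mul_extendByOne {l : ℕ} (hl : Even l) (A : Op n) :
    (bodyOp (n + 1) l * extendByOne A).trace = 2 * (bodyOp n l * A).trace := by
  simp only [bodyOp_eq, smul_mul_assoc, Matrix.trace_smul, Finset.sum_mul, Matrix.trace_sum]
  rw [smul_eq_mul, smul_eq_mul, mul_left_comm]
  congr 1
  rw [Finset.mul_sum]
  refine (Finset.sum_of_injOn (fun i => i.trans Fin.castSuccEmb) ?_ (by simp) ?_ ?_).symm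
  · intro i _ j _ h
    ext k
    exact congrArg Fin.val (Fin.castSucc_injective _ (DFunLike.congr_fun h k))
  · intro i _ hi
    refine trace_mul_eq_zero_of_sum_conj (a := Fin.last n) (sum_pauli_conj_pairing hl i ?_)
      fun w => commute_extendByOne_site_last A _
    by_contra h
    refine hi ⟨⟨fun k => (i k).castPred fun hk => h ⟨k, hk⟩, fun k k' hkk => ?_⟩, by simp, ?_⟩
    · exact i.injective (Fin.castPred_inj.1 hkk)
    · ext k
      exact congrArg Fin.val (Fin.castSucc_castPred (i k) fun hk => h ⟨k, hk⟩)
  · intro i _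
    rw [pairing_castSucc, ← extendHom_apply, ← extendHom_apply, ← map_mul, extendHom_apply,
      trace_extendByOne]

end SpinQubit

namespace SpinQubit

/-! ### Exponentials of Hermitian matrices -/

section Exponential

open scoped Matrix.Norms.L2Operator

variable {ι : Type*} [Fintype ι] [DecidableEq ι]

/-- The unitary `exp (i H)`. -/
noncomputable def expI (H : Matrix ι ι ℂ) : Matrix ι ι ℂ := NormedSpace.exp (Complex.I • H)

theorem expI_add {A B : Matrix ι ι ℂ} (h : Commute A B) : expI (A + B) = expI A * expI B := by
  rw [expI, smul_add, Matrix.exp_add_of_commute _ _ ((h.smul_left _).smul_right _)]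
  rfl

theorem expI_zero : expI (0 : Matrix ι ι ℂ) = 1 := by simp [expI, NormedSpace.exp_zero]

theorem commute_expI {A H : Matrix ι ι ℂ} (h : Commute A H) : Commute A (expI H) :=
  (h.smul_right _).exp_right

theorem expI_mem_unitaryGroup {H : Matrix ι ι ℂ} (hH : H.IsHermitian) :
    expI H ∈ Matrix.unitaryGroup ι ℂ := by
  rw [Matrix.mem_unitaryGroup_iff, Matrix.star_eq_conjTranspose]
  have : (expI H).conjTranspose = expI (-H) := by
    rw [expI, ← Matrix.exp_conjTranspose, Matrix.conjTranspose_smul, hH.eq, expI]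
    simp
  rw [this, ← expI_add ((Commute.refl H).neg_right), add_neg_cancel, expI_zero]

theorem expI_smul_one (t : ℝ) : expI ((t : ℂ) • (1 : Matrix ι ι ℂ))
    = Complex.exp (Complex.I * t) • 1 := by
  have h : ∀ c : ℂ, c • (1 : Matrix ι ι ℂ) = Matrix.diagonal fun _ => c := by
    intro c
    rw [Matrix.smul_one_eq_diagonal]
  rw [expI, smul_smul, h, h, Matrix.exp_diagonal, Complex.exp_eq_exp_ℂ]
  congr 1
  ext i
  rw [Pi.exp_def]

theorem det_expI {H : Matrix ι ι ℂ} (hH : H.IsHermitian) :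
    (expI H).det = Complex.exp (Complex.I * H.trace) := by
  have h1 := hH.spectral_theorem
  rw [Unitary.conjStarAlgAut_apply] at h1
  set U : Matrix ι ι ℂ := (hH.eigenvectorUnitary : Matrix ι ι ℂ) with hU
  have h2 : U * star U = 1 := Unitary.mul_star_self_of_mem hH.eigenvectorUnitary.2
  have h3 : U⁻¹ = star U := Matrix.inv_eq_right_inv h2
  have h4 : IsUnit U := IsUnit.of_mul_eq_one _ h2
  rw [hH.trace_eq_sum_eigenvalues, Finset.mul_sum, Complex.exp_sum, expI]
  nth_rw 1 [h1]
  rw [← h3, ← smul_mul_assoc, ← mul_smul_comm, Matrix.exp_conj _ _ h4, ← Matrix.diagonal_smul,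
    Matrix.exp_diagonal, Matrix.det_mul, Matrix.det_mul, mul_right_comm, ← Matrix.det_mul,
    Matrix.mul_nonsing_inv _ ((Matrix.isUnit_iff_isUnit_det _).1 h4), Matrix.det_one, one_mul,
    Matrix.det_diagonal]
  refine Finset.prod_congr rfl fun i _ => ?_
  rw [Pi.exp_def, Complex.exp_eq_exp_ℂ]
  rfl

/-- Only the constant term of the exponential series survives. -/
theorem exp_mul_of_mul_eq_zero {A B : Matrix ι ι ℂ} (h : A * B = 0) :
    NormedSpace.exp A * B = B := by
  have h1 := (NormedSpace.exp_series_hasSum_exp' (𝕂 := ℂ) A).mul_right B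
  have h2 : HasSum (fun k : ℕ => ((k.factorial : ℂ)⁻¹ • A ^ k) * B)
      (((Nat.factorial 0 : ℂ)⁻¹ • A ^ 0) * B) := by
    refine hasSum_single 0 fun k hk => ?_
    obtain ⟨m, rfl⟩ := Nat.exists_eq_succ_of_ne_zero hk
    rw [smul_mul_assoc, pow_succ, mul_assoc, h, mul_zero, smul_zero]
  simpa using h1.unique h2

/-- Used with P = Π_j: the component of exp(iH) in a sector, completed by the identity, is again an
exponential, so its determinant is given by a trace. -/
theorem expI_mul_idempotent {H P : Matrix ι ι ℂ} (hP : P * P = P) (h : Commute H P) :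
    expI (H * P) = expI H * P + (1 - P) := by
  have h1 : expI (H * P) * (1 - P) = 1 - P := by
    refine exp_mul_of_mul_eq_zero ?_
    rw [smul_mul_assoc, mul_assoc, mul_sub, hP, mul_one, sub_self, mul_zero, smul_zero]
  have h2 : expI (H * (1 - P)) * P = P := by
    refine exp_mul_of_mul_eq_zero ?_
    rw [smul_mul_assoc, mul_assoc, sub_mul, hP, one_mul, sub_self, mul_zero, smul_zero]
  have hc : Commute (H * P) (H * (1 - P)) :=
    ((Commute.refl H).mul_right ((Commute.one_right H).sub_right h)).mul_left
      (h.symm.mul_right ((Commute.one_right P).sub_right (Commute.refl P)))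
  have h3 : expI H = expI (H * P) * expI (H * (1 - P)) := by
    rw [← expI_add hc, ← mul_add, add_sub_cancel, mul_one]
  rw [h3, mul_assoc, h2, ← h1, ← mul_add, ← h1]
  rw [h1, add_sub_cancel, mul_one]

/-- Every unitary matrix is `exp (i H)`, where `H` is Hermitian and commutes with whatever commutes
with the given matrix. -/
theorem exists_expI_eq {V : Matrix ι ι ℂ} (hV : V ∈ Matrix.unitaryGroup ι ℂ) :
    ∃ H : Matrix ι ι ℂ, H.IsHermitian ∧ expI H = V ∧ ∀ A, Commute V A → Commute H A := by
  have hfin : (spectrum ℂ V).Finite := Matrix.finite_spectrum V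
  have hnorm : IsStarNormal V := ⟨by
    rw [Commute, SemiconjBy, Matrix.mem_unitaryGroup_iff.1 hV, Matrix.mem_unitaryGroup_iff'.1 hV]⟩
  -- The principal argument is discontinuous, but any function is continuous on a finite spectrum.
  have hcont : ∀ f : ℂ → ℂ, ContinuousOn f (spectrum ℂ V) := fun f => hfin.continuousOn f
  have hsa : IsSelfAdjoint (cfc (fun z : ℂ => (z.arg : ℂ)) V) := IsSelfAdjoint.cfc_arg V
  refine ⟨cfc (fun z : ℂ => (z.arg : ℂ)) V, hsa, ?_, ?_⟩
  · rw [expI, ← cfc_smul Complex.I _ V (hcont _), ← CFC.complex_exp_eq_normedSpace_exp,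
      ← cfc_comp' _ _ V (by fun_prop) (hcont _)]
    conv_rhs => rw [← cfc_id ℂ V]
    refine cfc_congr fun z hz => ?_
    have hz1 : ‖z‖ = 1 := spectrum.norm_eq_one_of_unitary hV hz
    have := Complex.norm_mul_exp_arg_mul_I z
    rw [hz1, Complex.ofReal_one, one_mul] at this
    simp only [smul_eq_mul, id_eq]
    rw [mul_comm, this]
  · intro A hA
    have h1 : Commute A (star V) := by
      have e1 := Matrix.mem_unitaryGroup_iff.1 hV
      have e2 := Matrix.mem_unitaryGroup_iff'.1 hV
      exact Commute.units_inv_right (u := ⟨V, star V, e1, e2⟩) hA.symm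
    exact Commute.cfc hA h1.symm _

theorem expI_extendByOne {n : ℕ} (H : Op n) : expI (extendByOne H) = extendByOne (expI H) := by
  rw [expI, expI, ← extendHom_apply, ← extendHom_apply, ← map_smul]
  let +nondep : NormedAlgebra ℚ (Op n) := NormedAlgebra.restrictScalars ℚ ℂ (Op n)
  let +nondep : Algebra ℚ (Op (n + 1)) := Algebra.restrictScalars ℚ ℂ (Op (n + 1))
  refine (NormedSpace.map_exp (extendHom n) ?_ _).symm
  exact (extendHom n).toLinearMap.continuous_of_finiteDimensional

end Exponential

end SpinQubit

namespace SpinQubit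

/-! ### The sectors -/

open scoped InnerProductSpace

variable {n : ℕ}

theorem act_eq (A : Op n) : act A = Matrix.toLpLinAlgEquiv 2 A := rfl

theorem act_mul (A B : Op n) : act (A * B) = act A * act B := by
  rw [act_eq, act_eq, act_eq, map_mul]

theorem act_mul_apply (A B : Op n) (v : Hilb n) : act (A * B) v = act A (act B v) := by
  rw [act_mul, Module.End.mul_apply]

theorem act_add (A B : Op n) : act (A + B) = act A + act B := by
  rw [act_eq, act_eq, act_eq, map_add]

theorem act_sub (A B : Op n) : act (A - B) = act A - act B := by
  rw [act_eq, act_eq, act_eq, map_sub]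

theorem act_smul (c : ℂ) (A : Op n) : act (c • A) = c • act A := by
  rw [act_eq, act_eq, map_smul]

theorem act_one : act (1 : Op n) = 1 := by
  rw [act_eq, map_one]

theorem act_injective : Function.Injective (act (n := n)) :=
  (Matrix.toLpLinAlgEquiv (R := ℂ) (n := Bits n) 2).injective

theorem act_commute {A B : Op n} (h : Commute A B) : Commute (act A) (act B) := by
  rw [Commute, SemiconjBy, ← act_mul, h.eq, act_mul]

theorem act_apply_apply (A : Op n) (v : Hilb n) (x : Bits n) :
    act A v x = ∑ y, A x y * v y := rfl

theorem inner_act (A : Op n) (x y : Hilb n) : ⟪act A.conjTranspose x, y⟫_ℂ = ⟪x, act A y⟫_ℂ := by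
  rw [act, Matrix.toEuclideanLin_conjTranspose_eq_adjoint, LinearMap.adjoint_inner_left, act]

theorem trace_act (A : Op n) : LinearMap.trace ℂ (Hilb n) (act A) = A.trace := by
  rw [act, Matrix.toEuclideanLin, Matrix.toLpLin_eq_toLin, Matrix.trace_toLin_eq]

theorem det_act (A : Op n) : LinearMap.det (act A) = A.det := LinearMap.det_toLpLin 2 A

theorem isSpinTriple (n : ℕ) :
    IsSpinTriple (act (weightOp n)) (act (raising n)) (act (lowering n)) where
  symm x y := by rw [← inner_act, weightOp_conjTranspose]
  adj x y := by rw [← inner_act, ← raising_conjTranspose, Matrix.conjTranspose_conjTranspose]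
  raise_lower := by
    rw [← act_mul, ← act_mul, ← act_add, ← act_add, raising_mul_lowering, two_smul]
  weight_raise := by rw [← act_mul, ← act_mul, ← act_add, weightOp_mul_raising]
  weight_lower := by rw [← act_mul, ← act_mul, ← act_sub, weightOp_mul_lowering]

theorem casimir_eq : IsSpinTriple.casimir (act (weightOp n)) (act (raising n)) (act (lowering n))
    = act (angMomSq n) := by
  rw [IsSpinTriple.casimir, ← act_mul, ← act_mul, ← act_add, ← act_add, angMomSq_eq]

theorem mem_sector {j : ℝ} {v : Hilb n} :
    v ∈ sector n j ↔ act (angMomSq n) v = ((j * (j + 1) : ℝ) : ℂ) • v :=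
  Module.End.mem_eigenspace_iff

theorem angMomSq_conjTranspose : (angMomSq n).conjTranspose = angMomSq n := by
  rw [angMomSq_eq, Matrix.conjTranspose_add, Matrix.conjTranspose_add, Matrix.conjTranspose_mul,
    Matrix.conjTranspose_mul, weightOp_conjTranspose, raising_conjTranspose,
    ← raising_conjTranspose, Matrix.conjTranspose_conjTranspose]

theorem commute_angMomSq {A : Op n} (hA : ∀ B, Commute A (total n B)) : Commute A (angMomSq n) := by
  rw [angMomSq_eq]
  exact (((hA _).mul_right (hA _)).add_right ((hA _).mul_right (hA _))).add_right (hA _)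

/-- The orthogonal projection onto a sector, as a matrix. -/
noncomputable def projOp (n : ℕ) (j : ℝ) : Op n := (Matrix.toLpLinAlgEquiv 2).symm (sectorProj n j)

theorem act_projOp (j : ℝ) : act (projOp n j) = sectorProj n j := by
  rw [act_eq, projOp, AlgEquiv.apply_symm_apply]

theorem sectorProj_apply (j : ℝ) (v : Hilb n) :
    sectorProj n j v = (sector n j).starProjection v := rfl

theorem sectorProj_mem (j : ℝ) (v : Hilb n) : sectorProj n j v ∈ sector n j :=
  (sector n j).starProjection_apply_mem v

theorem projOp_mul_self (j : ℝ) : projOp n j * projOp n j = projOp n j := by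
  refine act_injective (LinearMap.ext fun v => ?_)
  rw [act_mul_apply, act_projOp, sectorProj_apply, sectorProj_apply,
    Submodule.starProjection_eq_self_iff]
  exact (sector n j).starProjection_apply_mem v

theorem projOp_isHermitian (j : ℝ) : (projOp n j).IsHermitian := by
  rw [← Matrix.isSymmetric_toEuclideanLin_iff]
  change (act (projOp n j)).IsSymmetric
  rw [act_projOp]
  exact (sector n j).starProjection_isSymmetric

/-- Both A and its adjoint commute with J², so A preserves the sector and its orthogonal complement.
-/
theorem commute_projOp {A : Op n} (hA : Commute A (angMomSq n)) (j : ℝ) :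
    Commute A (projOp n j) := by
  have hA' : Commute A.conjTranspose (angMomSq n) := by
    have := congrArg Matrix.conjTranspose hA.eq
    rw [Matrix.conjTranspose_mul, Matrix.conjTranspose_mul, angMomSq_conjTranspose] at this
    exact this.symm
  refine act_injective (LinearMap.ext fun v => ?_)
  rw [act_mul_apply, act_mul_apply, act_projOp, sectorProj_apply, sectorProj_apply]
  refine (Submodule.eq_starProjection_of_mem_orthogonal (K := sector n j) ?_ ?_).symm
  · exact eigenspace_invariant (act_commute hA.symm) _ ((sector n j).starProjection_apply_mem v)
  · rw [← map_sub]
    intro w hw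
    rw [← inner_act]
    exact (sector n j).sub_starProjection_mem_orthogonal v _
      (eigenspace_invariant (act_commute hA'.symm) _ hw)

theorem angMomSq_mul_projOp (j : ℝ) :
    angMomSq n * projOp n j = ((j * (j + 1) : ℝ) : ℂ) • projOp n j := by
  refine act_injective (LinearMap.ext fun v => ?_)
  rw [act_mul_apply, act_smul, LinearMap.smul_apply, act_projOp]
  exact mem_sector.1 (sectorProj_mem j v)

/-- Nonnegativity is essential: j (j + 1) is unchanged under j ↦ -1 - j. -/
theorem projOp_mul_projOp {j k : ℝ} (hj : 0 ≤ j) (hk : 0 ≤ k) (h : j ≠ k) :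
    projOp n j * projOp n k = 0 := by
  have h1 : projOp n j * (angMomSq n * projOp n k)
      = (angMomSq n * projOp n j) * projOp n k := by
    rw [← mul_assoc, (commute_projOp (Commute.refl (angMomSq n)) j).eq]
  rw [angMomSq_mul_projOp, angMomSq_mul_projOp, mul_smul_comm, smul_mul_assoc, ← sub_eq_zero,
    ← sub_smul] at h1
  refine (smul_eq_zero.1 h1).resolve_left fun h2 => h ?_
  have h3 : k * (k + 1) = j * (j + 1) := by exact_mod_cast sub_eq_zero.1 h2
  nlinarith

theorem weightOp_apply (x y : Bits n) :
    weightOp n x y = if x = y then (n : ℂ) / 2 - ∑ i, ((x i : ℕ) : ℂ) else 0 := by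
  have h1 : ∀ i, site i ((1 / 2 : ℂ) • !![1, 0; 0, -1]) x y
      = if x = y then 1 / 2 - ((x i : ℕ) : ℂ) else 0 := by
    intro i
    rw [site_apply]
    by_cases hxy : x = y
    · subst hxy
      rw [if_pos fun _ _ => rfl, if_pos rfl]
      generalize x i = b
      fin_cases b <;> simp
      norm_num
    · rw [if_neg hxy]
      split_ifs with h
      · have hi : x i ≠ y i := by
          intro hi
          refine hxy (funext fun k => ?_)
          rcases eq_or_ne k i with rfl | hk
          · exact hi
          · exact h k hk
        generalize x i = a at hi
        generalize y i = b at hi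
        fin_cases a <;> fin_cases b <;> simp at hi ⊢
      · rfl
  rw [weightOp, total_apply, Matrix.sum_apply, Finset.sum_congr rfl fun i _ => h1 i]
  split_ifs
  · rw [Finset.sum_sub_distrib]
    simp [div_eq_mul_inv]
  · simp

/-- J_z is diagonal in the computational basis, with entry n/2 minus the number of ones. -/
theorem weight_mem {μ : ℝ} (hμ : 0 ≤ μ) {v : Hilb n} (hv : v ≠ 0)
    (h : act (weightOp n) v = (μ : ℂ) • v) :
    ∃ r ∈ Finset.range (n / 2 + 1), μ = (n : ℝ) / 2 - r := by
  obtain ⟨x, hx⟩ : ∃ x, v x ≠ 0 := by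
    by_contra! h0
    exact hv (PiLp.ext h0)
  have h1 : act (weightOp n) v x = (μ : ℂ) * v x := by rw [h]; rfl
  rw [act_apply_apply] at h1
  simp only [weightOp_apply, ite_mul, zero_mul, Finset.sum_ite_eq, Finset.mem_univ, if_true] at h1
  have h2 := mul_right_cancel₀ hx h1
  have h3 : (n : ℝ) / 2 - ((∑ i, (x i : ℕ) : ℕ) : ℝ) = μ := by
    have : (((n : ℝ) / 2 - ((∑ i, (x i : ℕ) : ℕ) : ℝ) : ℝ) : ℂ) = (μ : ℂ) := by
      rw [← h2]
      push_cast
      rfl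
    exact_mod_cast this
  refine ⟨_, ?_, h3.symm⟩
  have h4 : 2 * ∑ i, (x i : ℕ) ≤ n := by
    have : 2 * ((∑ i, (x i : ℕ) : ℕ) : ℝ) ≤ n := by linarith
    exact_mod_cast this
  rw [Finset.mem_range]
  omega

theorem spin_nonneg {r : ℕ} (hr : r ∈ Finset.range (n / 2 + 1)) : 0 ≤ (n : ℝ) / 2 - r := by
  have h1 : 2 * r ≤ n := by
    rw [Finset.mem_range] at hr
    omega
  have : (2 : ℝ) * r ≤ n := by exact_mod_cast h1
  linarith

/-- What remains of v after removing its components is orthogonal to every sector, and the sectors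
exhaust the possible highest weights. -/
theorem sum_projOp (n : ℕ) : ∑ r ∈ Finset.range (n / 2 + 1), projOp n ((n : ℝ) / 2 - r) = 1 := by
  refine act_injective (LinearMap.ext fun v => ?_)
  rw [act_one, Module.End.one_apply, eq_comm, ← sub_eq_zero]
  refine (isSpinTriple n).eq_zero_of_forall_mem_orthogonal
    (S := {μ | ∃ r ∈ Finset.range (n / 2 + 1), μ = (n : ℝ) / 2 - r})
    (fun μ hμ v hv h => weight_mem hμ hv h) ?_
  rintro _ ⟨r, hr, rfl⟩
  rw [casimir_eq]
  change _ ∈ (sector n _)ᗮ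
  rw [← Submodule.ker_starProjection, LinearMap.mem_ker]
  change sectorProj n _ _ = 0
  rw [← act_projOp, map_sub, ← act_mul_apply, Finset.mul_sum, Finset.sum_eq_single r,
    projOp_mul_self, sub_self]
  · intro s hs hsr
    refine projOp_mul_projOp (spin_nonneg hr) (spin_nonneg hs) fun h => hsr ?_
    have : (s : ℝ) = r := by linarith
    exact_mod_cast this
  · exact fun h => absurd hr h

/-! ### The eigenvalues of `C_l` -/

theorem commute_bodyOp_total (l : ℕ) (B : Matrix (Fin 2) (Fin 2) ℂ) :
    Commute (bodyOp n l) (total n B) := (bodyOp_isRotInvariant l).commute_total B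

theorem exists_bodyOp_eigenvalue (l : ℕ) {j : ℝ} (hj : 0 ≤ j) :
    ∃ c : ℂ, ∀ v ∈ sector n j, act (bodyOp n l) v = c • v := by
  have h1 : act (bodyOp n l) ∈
      Algebra.adjoin ℂ {act (weightOp n), act (raising n), act (lowering n)} := by
    have h2 : bodyOp n l ∈ collective n := bodyOp_mem_collective l
    rw [collective_eq] at h2
    let f : Op n →ₐ[ℂ] Module.End ℂ (Hilb n) := (Matrix.toLpLinAlgEquiv 2).toAlgHom
    have h3 : f (bodyOp n l) ∈ (Algebra.adjoin ℂ {weightOp n, raising n, lowering n}).map f :=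
      Subalgebra.mem_map.2 ⟨_, h2, rfl⟩
    rw [AlgHom.map_adjoin, Set.image_insert_eq, Set.image_pair] at h3
    exact h3
  obtain ⟨c, hc⟩ := (isSpinTriple n).exists_smul_of_mem_adjoin h1
    (act_commute (commute_bodyOp_total l _)) (act_commute (commute_bodyOp_total l _)) hj
  refine ⟨c, fun v hv => hc v ?_⟩
  rw [casimir_eq]
  exact mem_sector.1 hv

/-- Integrality is what makes Φ_l well defined modulo 2π, since the argument of a determinant
carries that ambiguity. -/
theorem exists_int_bodyEigenvalue (l : ℕ) {r : ℕ} (hr : r ∈ Finset.range (n / 2 + 1)) :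
    ∃ z : ℤ, bodyEigenvalue n l ((n : ℝ) / 2 - r) = z ∧
      bodyOp n l * projOp n ((n : ℝ) / 2 - r) = (z : ℂ) • projOp n ((n : ℝ) / 2 - r) := by
  set j := (n : ℝ) / 2 - r with hj
  obtain ⟨c, hc⟩ := exists_bodyOp_eigenvalue (n := n) l (spin_nonneg hr)
  rw [← hj] at hc
  have hmul : bodyOp n l * projOp n j = c • projOp n j := by
    refine act_injective (LinearMap.ext fun v => ?_)
    rw [act_mul_apply, act_smul, LinearMap.smul_apply, act_projOp]
    exact hc _ (sectorProj_mem j v)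
  have hval : bodyEigenvalue n l j = (c * (projOp n j).trace / (projOp n j).trace).re := by
    rw [bodyEigenvalue, ← act_projOp]
    change ((LinearMap.trace ℂ (Hilb n)) (act (bodyOp n l) * act (projOp n j)) / _).re = _
    rw [← act_mul, hmul, trace_act, trace_act, Matrix.trace_smul, smul_eq_mul]
  -- For a zero sector the trace quotient is 0 / 0 = 0 by convention, so no proof that the sectors
  -- are nonzero is needed.
  by_cases hbot : sector n j = ⊥
  · have hP : projOp n j = 0 := by
      refine act_injective (LinearMap.ext fun v => ?_)
      have := sectorProj_mem j v
      rw [hbot, Submodule.mem_bot] at this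
      rw [act_projOp, this]
      simp [act_eq]
    exact ⟨0, by simp [hval, hP], by simp [hP]⟩
  · obtain ⟨v, hv, hv0⟩ := Submodule.exists_mem_ne_zero_of_ne_bot hbot
    obtain ⟨A, hA⟩ := bodyOp_mem_integerOps n l
    obtain ⟨B, hB⟩ := exists_angMomSq_eq_map n
    -- The eigenvalue j (j + 1) is rational, so the sector is the kernel of a rational matrix.
    let q : ℚ := ((n : ℚ) / 2 - r) * ((n : ℚ) / 2 - r + 1)
    have hBmap : (B - q • 1).map (algebraMap ℚ ℂ)
        = angMomSq n - ((j * (j + 1) : ℝ) : ℂ) • 1 := by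
      rw [hB, hj]
      ext x y
      simp only [Matrix.map_apply, Matrix.sub_apply, Matrix.smul_apply, Matrix.one_apply]
      split_ifs <;> simp [q]
    have hker : ∀ w : Bits n → ℂ, ((B - q • 1).map (algebraMap ℚ ℂ)).mulVec w = 0 ↔
        WithLp.toLp 2 w ∈ sector n j := by
      intro w
      rw [hBmap, mem_sector, Matrix.sub_mulVec, sub_eq_zero, Matrix.smul_mulVec, Matrix.one_mulVec]
      exact (WithLp.toLp_injective 2).eq_iff.symm
    obtain ⟨z, hz⟩ := exists_int_eq_of_eigenvalue A (B - q • 1) (c := c) (v := WithLp.ofLp v)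
      (fun h => hv0 (WithLp.ofLp_injective 2 h)) ((hker _).2 hv) fun w hw => by
        have h1 := hc _ ((hker w).1 hw)
        rw [← hA] at h1
        exact congrArg WithLp.ofLp h1
    have htr : (projOp n j).trace ≠ 0 := by
      intro h0
      have hidem : IsIdempotentElem (act (projOp n j)) := by
        rw [IsIdempotentElem, ← act_mul, projOp_mul_self]
      have h1 := LinearMap.IsIdempotentElem.eq_zero_of_trace_eq_zero hidem (by rw [trace_act, h0])
      refine hv0 ?_
      rw [← (Submodule.starProjection_eq_self_iff (K := sector n j)).2 hv, ← sectorProj_apply,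
        ← act_projOp, h1, LinearMap.zero_apply]
    exact ⟨z, by rw [hval, mul_div_cancel_right₀ _ htr, hz]; simp, by rw [hmul, hz]⟩

end SpinQubit

namespace SpinQubit

/-! ### The `l`-body phases -/

variable {n : ℕ}

/-- The block of A in the sector is completed by the identity on the orthogonal complement, which
replaces a determinant on a subspace by a matrix determinant. -/
theorem det_sectorPart {A : Op n} (hA : Commute A (angMomSq n)) (j : ℝ) :
    LinearMap.det (sectorPart A j) = (A * projOp n j + (1 - projOp n j)).det := by
  have hmem : ∀ v ∈ sector n j, act A v ∈ sector n j :=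
    eigenspace_invariant (act_commute hA.symm)
  let e := Submodule.prodEquivOfIsCompl (sector n j) (sector n j)ᗮ
    (Submodule.isCompl_orthogonal _)
  have h1 : act (A * projOp n j + (1 - projOp n j))
      = e.toLinearMap ∘ₗ LinearMap.prodMap (sectorPart A j) LinearMap.id ∘ₗ e.symm.toLinearMap := by
    refine LinearMap.ext fun v => ?_
    obtain ⟨⟨s, t⟩, rfl⟩ := e.surjective v
    have he : ∀ s t, e (s, t) = (s : Hilb n) + (t : Hilb n) := fun s t => rfl
    have hs : act (projOp n j) (s : Hilb n) = s := by
      rw [act_projOp, sectorProj_apply]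
      exact Submodule.starProjection_eq_self_iff.2 s.2
    have ht : act (projOp n j) (t : Hilb n) = 0 := by
      rw [act_projOp, sectorProj_apply, Submodule.starProjection_apply_eq_zero_iff]
      exact t.2
    have hpart : (sectorPart A j s : Hilb n) = act A s := by
      change (sector n j).starProjection (act A s) = act A s
      exact Submodule.starProjection_eq_self_iff.2 (hmem _ s.2)
    rw [LinearMap.comp_apply, LinearMap.comp_apply, LinearEquiv.coe_coe, LinearEquiv.coe_coe,
      LinearEquiv.symm_apply_apply, LinearMap.prodMap_apply, LinearMap.id_apply, he, he, hpart,
      act_add, act_sub, act_one, LinearMap.add_apply, LinearMap.sub_apply, Module.End.one_apply,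
      act_mul_apply, map_add, hs, ht, add_zero, add_sub_cancel_left]
  rw [← det_act, h1, LinearMap.det_conj, LinearMap.det_prodMap, LinearMap.det_id, mul_one]

theorem mul_projOp_mul {A B : Op n} (hB : Commute B (angMomSq n)) (j : ℝ) :
    (A * projOp n j + (1 - projOp n j)) * (B * projOp n j + (1 - projOp n j))
      = A * B * projOp n j + (1 - projOp n j) := by
  have h1 := (commute_projOp hB j).eq
  have h2 := projOp_mul_self (n := n) j
  have h3 : A * projOp n j * (B * projOp n j) = A * B * projOp n j := by
    rw [mul_assoc A, ← mul_assoc (projOp n j) B, ← h1, mul_assoc B, h2, mul_assoc]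
  have h4 : (1 - projOp n j) * (B * projOp n j) = 0 := by
    rw [h1, ← mul_assoc, sub_mul, h2, one_mul, sub_self, zero_mul]
  have h5 : A * projOp n j * (1 - projOp n j) = 0 := by
    rw [mul_assoc, mul_sub, h2, mul_one, sub_self, mul_zero]
  have h6 : (1 - projOp n j) * (1 - projOp n j) = 1 - projOp n j := by
    rw [mul_sub, mul_one, sub_mul, h2, one_mul, sub_self, sub_zero]
  rw [add_mul, mul_add, mul_add, h3, h4, h5, h6, add_zero, zero_add]

theorem det_sectorPart_mul {A B : Op n} (hA : Commute A (angMomSq n))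
    (hB : Commute B (angMomSq n)) (j : ℝ) :
    LinearMap.det (sectorPart (A * B) j)
      = LinearMap.det (sectorPart A j) * LinearMap.det (sectorPart B j) := by
  rw [det_sectorPart (hA.mul_left hB), det_sectorPart hA, det_sectorPart hB, ← Matrix.det_mul,
    mul_projOp_mul hB]

theorem det_sectorPart_one (j : ℝ) : LinearMap.det (sectorPart (1 : Op n) j) = 1 := by
  rw [det_sectorPart (Commute.one_left _), one_mul, add_sub_cancel, Matrix.det_one]

/-- Integer coefficients allow the sum to be taken in `Real.Angle`, where the argument is additive
and, away from 0, continuous. -/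
theorem bodyPhase_eq_sum (l : ℕ) : ∃ z : ℕ → ℤ,
    (∀ r ∈ Finset.range (n / 2 + 1), bodyOp n l * projOp n ((n : ℝ) / 2 - r)
      = (z r : ℂ) • projOp n ((n : ℝ) / 2 - r)) ∧
    ∀ V : Op n, bodyPhase l V = ∑ r ∈ Finset.range (n / 2 + 1),
      z r • (Complex.arg (LinearMap.det (sectorPart V ((n : ℝ) / 2 - r))) : Real.Angle) := by
  have h := fun r : ℕ => fun hr : r ∈ Finset.range (n / 2 + 1) =>
    exists_int_bodyEigenvalue (n := n) l hr
  choose! z hz using h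
  refine ⟨z, fun r hr => (hz r hr).2, fun V => ?_⟩
  rw [bodyPhase, ← Real.Angle.coe_coeHom, map_sum]
  refine Finset.sum_congr rfl fun r hr => ?_
  rw [(hz r hr).1, Real.Angle.coe_coeHom, Real.Angle.intCast_mul_eq_zsmul]

theorem arg_exp_coe (x : ℝ) : (Complex.arg (Complex.exp (Complex.I * x)) : Real.Angle) = x := by
  rw [mul_comm, Complex.exp_mul_I, ← Complex.ofReal_cos, ← Complex.ofReal_sin]
  exact Complex.arg_cos_add_sin_mul_I_coe_angle x

theorem isHermitian_trace_eq {ι : Type*} [Fintype ι] {H : Matrix ι ι ℂ} (hH : H.IsHermitian) :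
    H.trace = (H.trace.re : ℝ) := by
  rw [eq_comm, ← Complex.conj_eq_iff_re, ← Complex.star_def, ← Matrix.trace_conjTranspose, hH.eq]

theorem det_sectorPart_expI {H : Op n} (hH : H.IsHermitian) (hc : Commute H (angMomSq n)) (j : ℝ) :
    LinearMap.det (sectorPart (expI H) j)
      = Complex.exp (Complex.I * ((H * projOp n j).trace.re : ℝ)) := by
  have hP := commute_projOp hc j
  have hHP : (H * projOp n j).IsHermitian := by
    rw [Matrix.IsHermitian, Matrix.conjTranspose_mul, hH.eq, (projOp_isHermitian j).eq, hP.eq]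
  rw [det_sectorPart (commute_expI hc.symm).symm, ← expI_mul_idempotent (projOp_mul_self j) hP,
    det_expI hHP, ← isHermitian_trace_eq hHP]

/-- The `l`-body phase of `exp (i H)` is `Tr (C_l H)`. -/
theorem bodyPhase_expI (l : ℕ) {H : Op n} (hH : H.IsHermitian) (hc : Commute H (angMomSq n)) :
    bodyPhase l (expI H) = ((bodyOp n l * H).trace.re : ℝ) := by
  obtain ⟨z, hz, h⟩ := bodyPhase_eq_sum (n := n) l
  have htr : bodyOp n l * H
      = ∑ r ∈ Finset.range (n / 2 + 1), (z r : ℂ) • (H * projOp n ((n : ℝ) / 2 - r)) := by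
    conv_lhs => rw [← mul_one H, ← sum_projOp n, Finset.mul_sum, Finset.mul_sum]
    refine Finset.sum_congr rfl fun r hr => ?_
    rw [(commute_projOp hc _).eq, ← mul_assoc, hz r hr, smul_mul_assoc]
  rw [h, htr, Matrix.trace_sum, Complex.re_sum, ← Real.Angle.coe_coeHom, map_sum]
  refine Finset.sum_congr rfl fun r _ => ?_
  rw [det_sectorPart_expI hH hc, Real.Angle.coe_coeHom, arg_exp_coe, Matrix.trace_smul, smul_eq_mul,
    ← Complex.ofReal_intCast, Complex.re_ofReal_mul, Real.Angle.intCast_mul_eq_zsmul]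

/-- Symmetric unitaries, infinitesimally: unitaries commuting with the angular momentum. -/
def IsSymm (V : Op n) : Prop :=
  V ∈ Matrix.unitaryGroup (Bits n) ℂ ∧ ∀ B, Commute V (total n B)

theorem isSymm_of_mem {V : Matrix.unitaryGroup (Bits n) ℂ} (hV : V ∈ symUnitary n) :
    IsSymm (V : Op n) :=
  ⟨V.2, fun B => IsRotInvariant.commute_total hV B⟩

theorem IsSymm.commute_angMomSq {V : Op n} (hV : IsSymm V) : Commute V (angMomSq n) :=
  SpinQubit.commute_angMomSq hV.2

theorem IsSymm.exists_expI {V : Op n} (hV : IsSymm V) :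
    ∃ H : Op n, H.IsHermitian ∧ expI H = V ∧ Commute H (angMomSq n) ∧
      (∀ B, Commute H (total n B)) ∧ ∀ A, Commute V A → Commute H A := by
  obtain ⟨H, hH, hHV, h⟩ := exists_expI_eq hV.1
  exact ⟨H, hH, hHV, h _ hV.commute_angMomSq, fun B => h _ (hV.2 B), h⟩

theorem IsSymm.det_ne_zero {V : Op n} (hV : IsSymm V) (j : ℝ) :
    LinearMap.det (sectorPart V j) ≠ 0 := by
  obtain ⟨H, hH, rfl, hc, -⟩ := hV.exists_expI
  rw [det_sectorPart_expI hH hc]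
  exact Complex.exp_ne_zero _

theorem bodyPhase_mul (l : ℕ) {V W : Op n} (hV : IsSymm V) (hW : IsSymm W) :
    bodyPhase l (V * W) = bodyPhase l V + bodyPhase l W := by
  obtain ⟨z, -, h⟩ := bodyPhase_eq_sum (n := n) l
  rw [h, h, h, ← Finset.sum_add_distrib]
  refine Finset.sum_congr rfl fun r _ => ?_
  rw [det_sectorPart_mul hV.commute_angMomSq hW.commute_angMomSq,
    Complex.arg_mul_coe_angle (hV.det_ne_zero _) (hW.det_ne_zero _), smul_add]

theorem bodyPhase_one (l : ℕ) : bodyPhase l (1 : Op n) = 0 := by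
  obtain ⟨z, -, h⟩ := bodyPhase_eq_sum (n := n) l
  rw [h]
  simp [det_sectorPart_one]

theorem bodyPhase_extendByOne {l : ℕ} (hl : Even l) {V : Op n} (hV : IsSymm V) :
    bodyPhase l (extendByOne V) = (2 : ℕ) • bodyPhase l V := by
  obtain ⟨H, hH, rfl, hc, hB, -⟩ := hV.exists_expI
  have h1 : (extendByOne H).IsHermitian := by
    rw [Matrix.IsHermitian, extendByOne_conjTranspose, hH.eq]
  rw [← expI_extendByOne, bodyPhase_expI l h1 (commute_angMomSq (commute_extendByOne_total hB)),
    bodyPhase_expI l hH hc, trace_bodyOp_mul_extendByOne hl, ← Real.Angle.coe_nsmul]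
  simp

/-- A phase c adds arg(c) Tr(C_l), and `C_l` is traceless for l ≥ 2. For l = 0 the added term is
arg(c) times the dimension, whence the restriction. -/
theorem bodyPhase_smul {l : ℕ} (hl : Even l) (hl2 : 2 ≤ l) {V : Op n} (hV : IsSymm V) {c : ℂ}
    (hc : ‖c‖ = 1) : bodyPhase l (c • V) = bodyPhase l V := by
  obtain ⟨H, hH, rfl, hcom, -⟩ := hV.exists_expI
  have h1 : c • expI H = expI ((c.arg : ℂ) • 1 + H) := by
    rw [expI_add ((Commute.one_left H).smul_left _), expI_smul_one, smul_one_mul]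
    congr 1
    have := Complex.norm_mul_exp_arg_mul_I c
    rw [hc, Complex.ofReal_one, one_mul] at this
    rw [mul_comm, this]
  have h2 : ((c.arg : ℂ) • (1 : Op n) + H).IsHermitian := by
    rw [Matrix.IsHermitian, Matrix.conjTranspose_add, hH.eq, Matrix.conjTranspose_smul,
      Matrix.conjTranspose_one, Complex.star_def, Complex.conj_ofReal]
  rw [h1, bodyPhase_expI l h2 (((Commute.one_left _).smul_left _).add_left hcom),
    bodyPhase_expI l hH hcom, mul_add, Matrix.trace_add, mul_smul_comm, Matrix.trace_smul,
    trace_bodyOp_mul_eq_zero hl (S := ∅) (by simpa using by omega)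
        (fun _ _ _ => Commute.one_left _),
    smul_zero, zero_add]

/-! ### Locality and the vanishing of phases. -/

theorem mul_site_apply (A : Op n) (a : Fin n) (M : Matrix (Fin 2) (Fin 2) ℂ) (x y : Bits n) :
    (A * site a M) x y = ∑ b, A x (Function.update y a b) * M b (y a) := by
  rw [Matrix.mul_apply]
  refine (Finset.sum_of_injOn (fun b => Function.update y a b)
    (Function.update_injective y a).injOn (by simp) ?_ ?_).symm
  · intro z _ hz
    rw [site_apply, if_neg, mul_zero]
    refine fun h => hz ⟨z a, by simp, ?_⟩
    ext1 k
    rcases eq_or_ne k a with rfl | hk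
    · simp
    · simp [hk, h k hk]
  · intro b _
    rw [site_apply, if_pos fun j hj => by simp [hj], Function.update_self]

theorem site_mul_apply (A : Op n) (a : Fin n) (M : Matrix (Fin 2) (Fin 2) ℂ) (x y : Bits n) :
    (site a M * A) x y = ∑ b, M (x a) b * A (Function.update x a b) y := by
  rw [Matrix.mul_apply]
  refine (Finset.sum_of_injOn (fun b => Function.update x a b)
    (Function.update_injective x a).injOn (by simp) ?_ ?_).symm
  · intro z _ hz
    rw [site_apply, if_neg, zero_mul]
    refine fun h => hz ⟨z a, by simp, ?_⟩
    ext1 k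
    rcases eq_or_ne k a with rfl | hk
    · simp
    · simp [hk, h k hk]
  · intro b _
    rw [site_apply, if_pos fun j hj => by simp [hj], Function.update_self]

/-- Locality as a commutation property: in this form it passes from a unitary to its logarithm. -/
theorem IsLocal.exists_commute_site {k : ℕ} {A : Op n} (hA : IsLocal k A) :
    ∃ S : Finset (Fin n), S.card ≤ k ∧ ∀ a, a ∉ S → ∀ M, Commute A (site a M) := by
  obtain ⟨S, hS, B, hB⟩ := hA
  refine ⟨S, hS, fun a ha M => ?_⟩
  have hne : ∀ i : S, (i : Fin n) ≠ a := fun i h => ha (h ▸ i.2)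
  have hcond : ∀ (x y : Bits n) (b : Fin 2), (∀ i, i ∉ S → x i = Function.update y a b i) ↔
      b = x a ∧ ∀ i, i ∉ S → i ≠ a → x i = y i := by
    intro x y b
    constructor
    · intro h
      refine ⟨by simpa using (h a ha).symm, fun i hi hia => ?_⟩
      simpa [hia] using h i hi
    · rintro ⟨rfl, h⟩ i hi
      rcases eq_or_ne i a with rfl | hia
      · simp
      · simpa [hia] using h i hi hia
  have hcond' : ∀ (x y : Bits n) (b : Fin 2), (∀ i, i ∉ S → Function.update x a b i = y i) ↔
      b = y a ∧ ∀ i, i ∉ S → i ≠ a → x i = y i := by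
    intro x y b
    simpa only [eq_comm] using hcond y x b
  rw [Commute, SemiconjBy]
  ext x y
  rw [mul_site_apply, site_mul_apply]
  simp only [hB, hcond, hcond', Function.update_of_ne (hne _), ite_and]
  simp [mul_comm]

theorem bodyPhase_eq_zero_of_isLocal {k l : ℕ} (hl : Even l) (hkl : k < l) {V : Op n}
    (hV : IsSymm V) (hloc : IsLocal k V) : bodyPhase l V = 0 := by
  obtain ⟨S, hS, hcomm⟩ := hloc.exists_commute_site
  obtain ⟨H, hH, rfl, hc, -, hA⟩ := hV.exists_expI
  rw [bodyPhase_expI l hH hc, trace_bodyOp_mul_eq_zero hl (S := S) (by omega)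
    fun a ha w => hA _ (hcomm a ha _)]
  simp

theorem localSymUnitary_le (n k : ℕ) : localSymUnitary n k ≤ symUnitary n :=
  (Subgroup.closure_le _).2 fun _ hV => hV.1

theorem bodyPhase_eq_zero_of_mem_localSymUnitary {k l : ℕ} (hl : Even l) (hkl : k < l)
    {V : Matrix.unitaryGroup (Bits n) ℂ} (hV : V ∈ localSymUnitary n k) :
    bodyPhase l (V : Op n) = 0 := by
  induction hV using Subgroup.closure_induction with
  | mem V hV => exact bodyPhase_eq_zero_of_isLocal hl hkl (isSymm_of_mem hV.1) hV.2
  | one => exact bodyPhase_one l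
  | mul V W hV hW h1 h2 =>
    have := bodyPhase_mul l (isSymm_of_mem (localSymUnitary_le n k hV))
      (isSymm_of_mem (localSymUnitary_le n k hW))
    rw [h1, h2, add_zero] at this
    exact this
  | inv V hV h1 =>
    have hV' := localSymUnitary_le n k hV
    have := bodyPhase_mul l (isSymm_of_mem hV') (isSymm_of_mem (inv_mem hV'))
    rw [h1, zero_add, ← Submonoid.coe_mul, mul_inv_cancel] at this
    rw [← this]
    exact bodyPhase_one l

end SpinQubit

namespace SpinQubit

/-! ### Implementation with one ancilla -/

variable {n : ℕ}

open scoped InnerProductSpace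

theorem withAncilla_apply (ψ : Hilb n) (η : EuclideanSpace ℂ (Fin 2)) (x : Bits (n + 1)) :
    withAncilla ψ η x = ψ (Fin.init x) * η (x (Fin.last n)) := rfl

theorem withAncilla_snoc (ψ : Hilb n) (η : EuclideanSpace ℂ (Fin 2)) (x : Bits n) (b : Fin 2) :
    withAncilla ψ η (Fin.snoc (α := fun _ => Fin 2) x b) = ψ x * η b := by
  have h : Fin.snoc (α := fun _ => Fin 2) x b (Fin.last n) = b :=
    Fin.snoc_last (α := fun _ => Fin 2) b x
  rw [withAncilla_apply, Fin.init_snoc, h]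

theorem hilb_ext_snoc {v w : Hilb (n + 1)} (h : ∀ (x : Bits n) (b : Fin 2),
    v (Fin.snoc (α := fun _ => Fin 2) x b) = w (Fin.snoc (α := fun _ => Fin 2) x b)) : v = w :=
  PiLp.ext (forall_bits_succ.2 h)

theorem withAncilla_add_left (ψ φ : Hilb n) (η : EuclideanSpace ℂ (Fin 2)) :
    withAncilla (ψ + φ) η = withAncilla ψ η + withAncilla φ η :=
  hilb_ext_snoc fun x b => by simp [withAncilla_snoc, add_mul]

theorem withAncilla_smul_left (c : ℂ) (ψ : Hilb n) (η : EuclideanSpace ℂ (Fin 2)) :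
    withAncilla (c • ψ) η = c • withAncilla ψ η :=
  hilb_ext_snoc fun x b => by simp [withAncilla_snoc, mul_assoc]

theorem withAncilla_smul_right (c : ℂ) (ψ : Hilb n) (η : EuclideanSpace ℂ (Fin 2)) :
    withAncilla ψ (c • η) = c • withAncilla ψ η :=
  hilb_ext_snoc fun x b => by simp [withAncilla_snoc, mul_left_comm]

theorem withAncilla_sum_left {ι : Type*} (s : Finset ι) (ψ : ι → Hilb n)
    (η : EuclideanSpace ℂ (Fin 2)) :
    withAncilla (∑ i ∈ s, ψ i) η = ∑ i ∈ s, withAncilla (ψ i) η := by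
  let f : Hilb n →ₗ[ℂ] Hilb (n + 1) :=
    { toFun := fun ψ => withAncilla ψ η
      map_add' := fun _ _ => withAncilla_add_left _ _ _
      map_smul' := fun _ _ => withAncilla_smul_left _ _ _ }
  exact map_sum f ψ s

theorem act_extendByOne (A : Op n) (ψ : Hilb n) (η : EuclideanSpace ℂ (Fin 2)) :
    act (extendByOne A) (withAncilla ψ η) = withAncilla (act A ψ) η := by
  refine hilb_ext_snoc fun x b => ?_
  rw [act_apply_apply, sum_bits_succ, withAncilla_snoc, act_apply_apply, Finset.sum_mul]
  refine Finset.sum_congr rfl fun y _ => ?_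
  simp only [extendByOne_snoc, withAncilla_snoc, Matrix.one_apply]
  fin_cases b <;> simp [mul_assoc]

theorem act_site_last (B : Matrix (Fin 2) (Fin 2) ℂ) (ψ : Hilb n) (η : EuclideanSpace ℂ (Fin 2)) :
    act (site (Fin.last n) B) (withAncilla ψ η) = withAncilla ψ (Matrix.toEuclideanLin B η) := by
  refine hilb_ext_snoc fun x b => ?_
  rw [act_apply_apply, sum_bits_succ, withAncilla_snoc]
  simp only [site_last_snoc, withAncilla_snoc]
  simp [Matrix.mulVec, dotProduct, mul_left_comm, mul_add]

theorem withAncilla_basis_injective (x : Bits n) {η η' : EuclideanSpace ℂ (Fin 2)}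
    (h : withAncilla (EuclideanSpace.single x 1) η = withAncilla (EuclideanSpace.single x 1) η') :
    η = η' := by
  ext b
  have := congrArg (fun v : Hilb (n + 1) => v (Fin.snoc (α := fun _ => Fin 2) x b)) h
  simpa [withAncilla_snoc] using this

/-- A linear map that acts trivially on the system, up to a possibly state-dependent state of the
ancilla, leaves the ancilla in a fixed state. -/
theorem exists_ancilla_of_forall {X : Op (n + 1)} {η : EuclideanSpace ℂ (Fin 2)}
    (h : ∀ ψ : Hilb n, ‖ψ‖ = 1 → ∃ η' : EuclideanSpace ℂ (Fin 2), ‖η'‖ = 1 ∧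
      act X (withAncilla ψ η) = withAncilla ψ η') :
    ∃ η' : EuclideanSpace ℂ (Fin 2), ‖η'‖ = 1 ∧
      ∀ ψ : Hilb n, act X (withAncilla ψ η) = withAncilla ψ η' := by
  have h1 : ∀ ψ : Hilb n, ψ ≠ 0 → ∃ η' : EuclideanSpace ℂ (Fin 2),
      act X (withAncilla ψ η) = withAncilla ψ η' := by
    intro ψ hψ
    obtain ⟨η', -, h'⟩ := h (((‖ψ‖⁻¹ : ℝ) : ℂ) • ψ) (by
      rw [norm_smul, Complex.norm_real, norm_inv, norm_norm,
        inv_mul_cancel₀ (norm_ne_zero_iff.2 hψ)])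
    refine ⟨η', ?_⟩
    rw [withAncilla_smul_left, withAncilla_smul_left, map_smul] at h'
    refine smul_right_injective _ ?_ h'
    simpa using hψ
  obtain ⟨η', hη', h0⟩ := h (EuclideanSpace.single 0 1) (by simp)
  have hbasis : ∀ x : Bits n, act X (withAncilla (EuclideanSpace.single x 1) η)
      = withAncilla (EuclideanSpace.single x 1) η' := by
    intro x
    by_cases hx : x = 0
    · rw [hx, h0]
    have hne : ∀ y : Bits n, EuclideanSpace.single y (1 : ℂ) ≠ 0 := fun y => by simp
    obtain ⟨α, hα⟩ := h1 (EuclideanSpace.single x 1) (hne x)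
    -- The superposition of two basis states yields one ancilla state β; comparing components at x
    -- and at 0 identifies it with the ancilla states of both.
    obtain ⟨β, hβ⟩ := h1 (EuclideanSpace.single x 1 + EuclideanSpace.single 0 1) (by
      intro h2
      have := congrArg (fun v : Hilb n => v x) h2
      simp [hx] at this)
    rw [withAncilla_add_left, withAncilla_add_left, map_add, hα, h0] at hβ
    have e1 : α = β := by
      ext b
      have := congrArg (fun v : Hilb (n + 1) => v (Fin.snoc (α := fun _ => Fin 2) x b)) hβ
      simpa [withAncilla_snoc, hx] using this
    have e2 : η' = β := by
      ext b
      have := congrArg (fun v : Hilb (n + 1) => v (Fin.snoc (α := fun _ => Fin 2) 0 b)) hβ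
      simpa [withAncilla_snoc, Ne.symm hx] using this
    rw [hα, e1, e2]
  refine ⟨η', hη', fun ψ => ?_⟩
  have hψ : ψ = ∑ x, ψ x • EuclideanSpace.single x (1 : ℂ) := by
    ext y
    simp [Pi.single_apply]
  rw [hψ, withAncilla_sum_left, withAncilla_sum_left, map_sum]
  refine Finset.sum_congr rfl fun x _ => ?_
  rw [withAncilla_smul_left, withAncilla_smul_left, map_smul, hbasis]

theorem eq_smul_one_of_forall_withAncilla {X : Op (n + 1)} {c : ℂ}
    (h : ∀ (ψ : Hilb n) (φ : EuclideanSpace ℂ (Fin 2)),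
      act X (withAncilla ψ φ) = c • withAncilla ψ φ) : X = c • 1 := by
  have hs : ∀ (x : Bits n) (b : Fin 2),
      withAncilla (EuclideanSpace.single x 1) (EuclideanSpace.single b 1)
        = EuclideanSpace.single (Fin.snoc (α := fun _ => Fin 2) x b) (1 : ℂ) := by
    intro x b
    refine hilb_ext_snoc fun y a => ?_
    rw [withAncilla_snoc]
    simp only [PiLp.single_apply, Fin.snoc_inj]
    split_ifs <;> simp_all
  refine op_ext_snoc fun x y a b => ?_
  have h1 := congrArg (fun v : Hilb (n + 1) => v (Fin.snoc (α := fun _ => Fin 2) x a))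
    (h (EuclideanSpace.single y 1) (EuclideanSpace.single b 1))
  simp only [hs] at h1
  rw [act_apply_apply] at h1
  simpa [PiLp.single_apply, Matrix.one_apply] using h1

/-- An operator that commutes with the total angular momentum and acts trivially on the system for
one initial state of the ancilla is scalar. -/
theorem eq_smul_one_of_commute_total {X : Op (n + 1)} (hX : ∀ B, Commute X (total (n + 1) B))
    {η η' : EuclideanSpace ℂ (Fin 2)} (hη : ‖η‖ = 1)
    (h : ∀ ψ : Hilb n, act X (withAncilla ψ η) = withAncilla ψ η') : X = ⟪η, η'⟫_ℂ • 1 := by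
  refine eq_smul_one_of_forall_withAncilla fun ψ φ => ?_
  -- Apply [X, total B] = 0 to ψ ⊗ η: the system part of `total` gives the same vector on both sides
  -- and cancels.
  have key : ∀ B, act X (withAncilla ψ (Matrix.toEuclideanLin B η))
      = withAncilla ψ (Matrix.toEuclideanLin B η') := by
    intro B
    have h1 := LinearMap.congr_fun (congrArg act (hX B).eq) (withAncilla ψ η)
    rw [act_mul_apply, act_mul_apply, h, total_succ, act_add, LinearMap.add_apply,
      LinearMap.add_apply, act_extendByOne, act_extendByOne, act_site_last, act_site_last, map_add,
      h, add_right_inj] at h1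
    exact h1
  -- The matrix |φ⟩⟨η| sends η to φ, as η is normalized, and η' to ⟨η, η'⟩ φ.
  have hB : ∀ v : EuclideanSpace ℂ (Fin 2),
      Matrix.toEuclideanLin (Matrix.vecMulVec (WithLp.ofLp φ) (star (WithLp.ofLp η))) v =
        ⟪η, v⟫_ℂ • φ := by
    intro v
    ext b
    simp [Matrix.mulVec, dotProduct, Matrix.vecMulVec_apply, PiLp.inner_apply, add_mul]
    ring
  have h2 := key (Matrix.vecMulVec (WithLp.ofLp φ) (star (WithLp.ofLp η)))
  rw [hB, hB, inner_self_eq_norm_sq_to_K, hη, withAncilla_smul_right, withAncilla_smul_right] at h2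
  simpa using h2

/-- Undoing V on the system leaves X, still rotationally invariant at the level of generators and
trivial on the system for the given η, hence scalar. That |c| = 1 follows from η' = c η with both
states normalized. -/
theorem Implements.exists_phase {V : Matrix.unitaryGroup (Bits n) ℂ} (hV : V ∈ symUnitary n)
    {W : Matrix.unitaryGroup (Bits (n + 1)) ℂ} (hW : W ∈ symUnitary (n + 1))
    {η : EuclideanSpace ℂ (Fin 2)} (hη : ‖η‖ = 1) (h : Implements (W : Op (n + 1)) (V : Op n) η) :
    ∃ c : ℂ, ‖c‖ = 1 ∧ (∀ ψ : Hilb n, act (W : Op (n + 1)) (withAncilla ψ η)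
        = withAncilla (act (V : Op n) ψ) (c • η)) ∧
      (W : Op (n + 1)) = c • extendByOne (V : Op n) := by
  set V' : Op n := ((V⁻¹ : Matrix.unitaryGroup (Bits n) ℂ) : Op n) with hV'
  have h1 : V' * (V : Op n) = 1 := by
    rw [hV', ← Submonoid.coe_mul, inv_mul_cancel]
    rfl
  have h2 : (V : Op n) * V' = 1 := by
    rw [hV', ← Submonoid.coe_mul, mul_inv_cancel]
    rfl
  set X : Op (n + 1) := extendByOne V' * (W : Op (n + 1)) with hXdef
  have hX : ∀ B, Commute X (total (n + 1) B) := fun B =>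
    (commute_extendByOne_total (isSymm_of_mem (inv_mem hV)).2 B).mul_left ((isSymm_of_mem hW).2 B)
  obtain ⟨η', hη', hXη⟩ := exists_ancilla_of_forall (X := X) (η := η) fun ψ hψ => by
    obtain ⟨η', hη', h3⟩ := h ψ hψ
    refine ⟨η', hη', ?_⟩
    rw [hXdef, act_mul_apply, h3, act_extendByOne, ← act_mul_apply, h1, act_one]
    rfl
  have hXc := eq_smul_one_of_commute_total hX hη hXη
  set c := ⟪η, η'⟫_ℂ with hc
  have hη'c : η' = c • η := by
    refine withAncilla_basis_injective (0 : Bits n) ?_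
    rw [← hXη, hXc, act_smul, act_one, withAncilla_smul_right]
    rfl
  have hWV : (W : Op (n + 1)) = c • extendByOne (V : Op n) := by
    have h3 : extendByOne (V : Op n) * X = W := by
      rw [hXdef, ← mul_assoc, ← extendHom_apply, ← extendHom_apply, ← map_mul, h2, map_one, one_mul]
    rw [← h3, hXc, mul_smul_comm, mul_one]
  refine ⟨c, ?_, fun ψ => ?_, hWV⟩
  · have := congrArg norm hη'c
    rw [hη', norm_smul, hη, mul_one] at this
    exact this.symm
  · rw [hWV, act_smul, LinearMap.smul_apply, act_extendByOne, withAncilla_smul_right]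

theorem isSymm_extendByOne {V : Op n} (hV : IsSymm V) : IsSymm (extendByOne V) := by
  refine ⟨?_, commute_extendByOne_total hV.2⟩
  rw [Matrix.mem_unitaryGroup_iff, Matrix.star_eq_conjTranspose, extendByOne_conjTranspose,
    ← extendHom_apply, ← extendHom_apply, ← map_mul, ← Matrix.star_eq_conjTranspose,
    Matrix.mem_unitaryGroup_iff.1 hV.1, map_one]

theorem Implements.bodyPhase_eq {V : Matrix.unitaryGroup (Bits n) ℂ} (hV : V ∈ symUnitary n)
    {W : Matrix.unitaryGroup (Bits (n + 1)) ℂ} (hW : W ∈ symUnitary (n + 1))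
    {η : EuclideanSpace ℂ (Fin 2)} (hη : ‖η‖ = 1) (h : Implements (W : Op (n + 1)) (V : Op n) η)
    {l : ℕ} (hl : Even l) (hl2 : 2 ≤ l) :
    bodyPhase l (W : Op (n + 1)) = (2 : ℕ) • bodyPhase l (V : Op n) := by
  obtain ⟨c, hc, -, hWV⟩ := h.exists_phase hV hW hη
  rw [hWV, bodyPhase_smul hl hl2 (isSymm_extendByOne (isSymm_of_mem hV)) hc,
    bodyPhase_extendByOne hl (isSymm_of_mem hV)]

theorem eq_extendByOne_of_forall {V : Matrix.unitaryGroup (Bits n) ℂ} (hV : V ∈ symUnitary n)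
    {W : Matrix.unitaryGroup (Bits (n + 1)) ℂ} (hW : W ∈ symUnitary (n + 1))
    {η : EuclideanSpace ℂ (Fin 2)} (hη : ‖η‖ = 1)
    (h : ∀ ψ : Hilb n, ‖ψ‖ = 1 → act (W : Op (n + 1)) (withAncilla ψ η)
      = withAncilla (act (V : Op n) ψ) η) : (W : Op (n + 1)) = extendByOne (V : Op n) := by
  have himp : Implements (W : Op (n + 1)) (V : Op n) η := fun ψ hψ => ⟨η, hη, h ψ hψ⟩
  obtain ⟨c, -, -, hWV⟩ := himp.exists_phase hV hW hη
  have h1 := h (EuclideanSpace.single 0 1) (by simp)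
  rw [hWV, act_smul, LinearMap.smul_apply, act_extendByOne, ← withAncilla_smul_left] at h1
  have hV1 : act ((V⁻¹ : Matrix.unitaryGroup (Bits n) ℂ) : Op n)
      (act (V : Op n) (EuclideanSpace.single 0 1)) = EuclideanSpace.single 0 1 := by
    rw [← act_mul_apply, ← Submonoid.coe_mul, inv_mul_cancel]
    change act 1 _ = _
    rw [act_one]
    rfl
  have h2 := congrArg (act (extendByOne ((V⁻¹ : Matrix.unitaryGroup (Bits n) ℂ) : Op n))) h1
  rw [act_extendByOne, act_extendByOne, map_smul, hV1, withAncilla_smul_left,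
    ← withAncilla_smul_right] at h2
  have h3 : c • η = (1 : ℂ) • η := by
    rw [one_smul]
    exact withAncilla_basis_injective _ h2
  have hη0 : η ≠ 0 := by
    rintro rfl
    simp at hη
  rw [hWV, smul_left_injective ℂ hη0 h3, one_smul]

end SpinQubit

namespace SpinQubit

/-! ### Genericity -/

variable {n : ℕ}

theorem IsGeneric.inter {G : Type*} [Group G] [TopologicalSpace G] {S T : Set G}
    (hS : IsGeneric S) (hT : IsGeneric T) : IsGeneric (S ∩ T) := by
  refine ⟨hS.1.inter hT.1, hS.2.1.inter_of_isOpen_left hT.2.1 hS.1, fun m hm μ hμ => ?_⟩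
  rw [Set.compl_inter]
  exact measure_union_null (hS.2.2 m hm μ hμ) (hT.2.2 m hm μ hμ)

theorem isGeneric_univ {G : Type*} [Group G] [TopologicalSpace G] :
    IsGeneric (Set.univ : Set G) :=
  ⟨isOpen_univ, dense_univ, fun _ _ _ _ => by simp⟩

theorem isGeneric_biInter {G ι : Type*} [Group G] [TopologicalSpace G] (s : Finset ι)
    {S : ι → Set G} (h : ∀ i ∈ s, IsGeneric (S i)) : IsGeneric {g | ∀ i ∈ s, g ∈ S i} := by
  classical
  induction s using Finset.induction_on with
  | empty => simpa using isGeneric_univ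
  | insert i s _ ih =>
    have : {g | ∀ k ∈ insert i s, g ∈ S k} = S i ∩ {g | ∀ k ∈ s, g ∈ S k} := by
      ext g
      simp
    rw [this]
    exact (h i (by simp)).inter (ih fun k hk => h k (by simp [hk]))

theorem coe_angle_ne_zero {x : ℝ} (h0 : x ≠ 0) (h : |x| < 2 * Real.pi) : (x : Real.Angle) ≠ 0 := by
  rw [Ne, Real.Angle.coe_eq_zero_iff]
  rintro ⟨k, hk⟩
  rw [← hk, zsmul_eq_mul, abs_mul, abs_of_pos Real.two_pi_pos] at h
  have h1 : |(k : ℝ)| < 1 := by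
    by_contra! h1
    nlinarith [Real.two_pi_pos]
  have h2 : k = 0 := by
    have : |k| < 1 := by exact_mod_cast h1
    exact Int.abs_lt_one_iff.1 this
  simp [h2] at hk
  exact h0 hk.symm

/-- The kernel complement of a continuous character that is nontrivial on a one-parameter family is
generic. -/
theorem isGeneric_ne_zero {G : Type*} [Group G] [TopologicalSpace G] [ContinuousMul G]
    [CompactSpace G] {φ : G → Real.Angle} (hφ : Continuous φ) (hmul : ∀ g h, φ (g * h) = φ g + φ h)
    {γ : ℝ → G} (hγ : Continuous γ) (hγ0 : γ 0 = 1) {a : ℝ} (ha : a ≠ 0)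
    (hφγ : ∀ t, φ (γ t) = ((t * a : ℝ) : Real.Angle)) : IsGeneric {g | φ g ≠ 0} := by
  refine ⟨isOpen_ne_fun hφ continuous_const, fun g => ?_, fun m hm μ hμ => ?_⟩
  · by_cases hg : φ g = 0
    · have h1 : Filter.Tendsto (fun t => g * γ t) (nhdsWithin 0 {0}ᶜ) (nhds g) := by
        have : Filter.Tendsto (fun t => g * γ t) (nhds 0) (nhds (g * γ 0)) :=
          (continuous_const.mul hγ).tendsto 0
        rw [hγ0, mul_one] at this
        exact this.mono_left nhdsWithin_le_nhds
      refine mem_closure_of_tendsto h1 ?_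
      have h2 : ∀ᶠ t : ℝ in nhdsWithin 0 {0}ᶜ, |t * a| < 2 * Real.pi := by
        have h3 : Filter.Tendsto (fun t : ℝ => |t * a|) (nhds 0) (nhds |0 * a|) :=
          ((continuous_id.mul continuous_const).abs).tendsto 0
        rw [zero_mul, abs_zero] at h3
        exact (h3.eventually (gt_mem_nhds Real.two_pi_pos)).filter_mono nhdsWithin_le_nhds
      filter_upwards [h2, self_mem_nhdsWithin] with t ht ht0
      rw [hmul, hg, zero_add, hφγ]
      exact coe_angle_ne_zero (mul_ne_zero ht0 ha) ht
    · exact subset_closure hg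
  · have hcompl : {g | φ g ≠ 0}ᶜ = {g | φ g = 0} := by
      ext g
      simp
    rw [hcompl]
    -- The level sets at 1/(k + 1) are left translates of preimages of the kernel along γ, hence of
    -- equal Haar measure. They are disjoint because the levels are distinct in (0, 1]. A finite
    -- total measure forces that common measure to be 0.
    let A : ℕ → Set G := fun k => {g | φ g = ((1 / (k + 1 : ℝ) : ℝ) : Real.Angle)}
    have hA : ∀ k, μ (A k) = μ {g | φ g = 0} := by
      intro k
      have : A k = (fun g => γ (-(1 / (k + 1 : ℝ) / a)) * g) ⁻¹' {g | φ g = 0} := by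
        ext g
        simp only [A, Set.mem_ofPred_eq, Set.mem_preimage, hmul, hφγ]
        rw [neg_mul, div_mul_cancel₀ _ ha, Real.Angle.coe_neg, neg_add_eq_zero, eq_comm]
      rw [this, measure_preimage_mul]
    have hdisj : Pairwise (Function.onFun Disjoint A) := by
      intro i j hij
      rw [Function.onFun, Set.disjoint_left]
      intro g hi hj
      have h1 : ((1 / (i + 1 : ℝ) - 1 / (j + 1 : ℝ) : ℝ) : Real.Angle) = 0 := by
        rw [Real.Angle.coe_sub, ← hi, ← hj, sub_self]
      refine coe_angle_ne_zero ?_ ?_ h1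
      · intro h2
        have h3 := sub_eq_zero.1 h2
        rw [one_div, one_div, inv_inj, add_left_inj] at h3
        exact hij (by exact_mod_cast h3)
      · have h2 : ∀ k : ℕ, 0 < 1 / (k + 1 : ℝ) ∧ 1 / (k + 1 : ℝ) ≤ 1 := fun k => by
          have : (0 : ℝ) ≤ k := k.cast_nonneg
          exact ⟨by positivity, (div_le_one (by positivity)).2 (by linarith)⟩
        rw [abs_lt]
        have := Real.pi_gt_three
        constructor <;> linarith [(h2 i).1, (h2 i).2, (h2 j).1, (h2 j).2]
    have hmeas : ∀ k, MeasurableSet (A k) := fun k =>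
      (isClosed_eq hφ continuous_const).measurableSet
    by_contra h0
    have h1 := measure_iUnion hdisj hmeas (μ := μ)
    simp only [hA] at h1
    rw [ENNReal.tsum_const_eq_top_of_ne_zero h0] at h1
    exact (measure_lt_top_of_subset (Set.subset_univ _) (isCompact_univ.measure_lt_top.ne)).ne h1

/-- The group is closed in the space of matrices, and unitary entries have modulus at most 1.
Compactness makes Haar measures finite. -/
instance : CompactSpace (symUnitary n) := by
  let f : symUnitary n → Op n := fun V => (V.1 : Op n)
  have hf : Topology.IsInducing f :=
    (Topology.IsInducing.subtypeVal (t := {A | A ∈ Matrix.unitaryGroup (Bits n) ℂ})).comp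
      Topology.IsInducing.subtypeVal
  rw [← isCompact_univ_iff, hf.isCompact_iff, Set.image_univ]
  have hrange : Set.range f = {A | A ∈ Matrix.unitaryGroup (Bits n) ℂ} ∩
      {A | IsRotInvariant A} := by
    ext A
    constructor
    · rintro ⟨V, rfl⟩
      exact ⟨V.1.2, V.2⟩
    · rintro ⟨h1, h2⟩
      exact ⟨⟨⟨A, h1⟩, h2⟩, rfl⟩
  have hclosed : IsClosed (Set.range f) := by
    rw [hrange]
    refine IsClosed.inter ?_ ?_
    · simp only [Matrix.mem_unitaryGroup_iff]
      exact isClosed_eq (continuous_id.mul continuous_star) continuous_const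
    · have : {A : Op n | IsRotInvariant A} = ⋂ U ∈ Matrix.unitaryGroup (Fin 2) ℂ,
          {A | A * tensorOp (fun _ => U) = tensorOp (fun _ => U) * A} := by
        ext A
        simp [IsRotInvariant, Commute, SemiconjBy]
      rw [this]
      exact isClosed_biInter fun U _ =>
        isClosed_eq (continuous_id.mul continuous_const) (continuous_const.mul continuous_id)
  have hK : IsCompact (Set.univ.pi fun _ => Set.univ.pi fun _ => Metric.closedBall 0 1 :
      Set (Op n)) :=
    isCompact_univ_pi fun _ => isCompact_univ_pi fun _ => isCompact_closedBall _ _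
  refine hK.of_isClosed_subset hclosed ?_
  rintro _ ⟨V, rfl⟩ x _ y _
  rw [mem_closedBall_zero_iff]
  exact entry_norm_bound_of_unitary V.1.2 x y

theorem continuous_bodyPhase (l : ℕ) {X : Type*} [TopologicalSpace X] {f : X → Op n}
    (hf : Continuous f) (h : ∀ x, IsSymm (f x)) : Continuous fun x => bodyPhase l (f x) := by
  obtain ⟨z, -, hz⟩ := bodyPhase_eq_sum (n := n) l
  simp only [hz]
  refine continuous_finsetSum _ fun r _ => Continuous.zsmul ?_ _
  rw [continuous_iff_continuousAt]
  intro x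
  refine (Complex.continuousAt_arg_coe_angle ((h x).det_ne_zero _)).comp (f := fun x =>
    LinearMap.det (sectorPart (f x) ((n : ℝ) / 2 - r))) ?_
  refine Continuous.continuousAt ?_
  have : (fun x => LinearMap.det (sectorPart (f x) ((n : ℝ) / 2 - r))) = fun x =>
      (f x * projOp n ((n : ℝ) / 2 - r) + (1 - projOp n ((n : ℝ) / 2 - r))).det :=
    funext fun x => det_sectorPart (h x).commute_angMomSq _
  rw [this]
  exact ((hf.mul continuous_const).add continuous_const).matrix_det

/-! ### Nontriviality of the phases along the flow of `C_l`. -/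

theorem bodyOp_isHermitian (l : ℕ) : (bodyOp n l).IsHermitian := by
  obtain ⟨z, hz, -⟩ := bodyPhase_eq_sum (n := n) l
  have : bodyOp n l
      = ∑ r ∈ Finset.range (n / 2 + 1), (z r : ℂ) • projOp n ((n : ℝ) / 2 - r) := by
    conv_lhs => rw [← mul_one (bodyOp n l), ← sum_projOp n, Finset.mul_sum]
    exact Finset.sum_congr rfl hz
  rw [this, Matrix.IsHermitian, Matrix.conjTranspose_sum]
  refine Finset.sum_congr rfl fun r _ => ?_
  rw [Matrix.conjTranspose_smul, (projOp_isHermitian _).eq]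
  simp

theorem exchange_act_single {r s : Fin n} (h : r ≠ s) :
    act (exchange r s) (EuclideanSpace.single 0 1) = (1 / 2 : ℂ) • EuclideanSpace.single 0 1 := by
  have h1 : act (permOp (Equiv.swap r s)) (EuclideanSpace.single 0 1)
      = EuclideanSpace.single 0 1 := by
    ext x
    rw [act_apply_apply]
    have h2 : x ∘ Equiv.swap r s = 0 ↔ x = 0 := by
      constructor
      · intro h
        ext k
        have := congrFun h (Equiv.swap r s k)
        simpa using this
      · rintro rfl
        rfl
    simp [permOp, PiLp.single_apply, h2]
  rw [exchange_eq h, act_sub, act_smul, act_one, LinearMap.sub_apply, h1]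
  simp only [LinearMap.smul_apply, Module.End.one_apply]
  module

theorem list_prod_act {L : List (Op n)} {v : Hilb n} {c : ℂ} (h : ∀ A ∈ L, act A v = c • v) :
    act L.prod v = c ^ L.length • v := by
  induction L with
  | nil => simp [act_one]
  | cons A L ih =>
    rw [List.prod_cons, act_mul_apply, ih fun B hB => h B (List.mem_cons_of_mem A hB), map_smul,
      h A List.mem_cons_self, smul_smul, List.length_cons, pow_succ]

/-- Swaps fix the state with all labels 0, so every exchange acts on it as 1/2 and the terms add up
without cancellation. The number of tuples is nonzero since l ≤ n. -/
theorem bodyOp_ne_zero {l : ℕ} (hl : l ≤ n) : bodyOp n l ≠ 0 := by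
  have h1 : ∀ i : Fin l ↪ Fin n, act (pairing i) (EuclideanSpace.single 0 1)
      = ((1 / 2 : ℂ) ^ (l / 2)) • EuclideanSpace.single 0 1 := by
    intro i
    rw [pairing_eq, list_prod_act (c := 1 / 2), List.length_ofFn]
    intro A hA
    rw [List.mem_ofFn] at hA
    obtain ⟨r, rfl⟩ := hA
    exact exchange_act_single (exchange_pair_ne i r)
  intro h0
  have h2 : act (bodyOp n l) (EuclideanSpace.single 0 1) = 0 := by
    rw [h0]
    simp [act_eq]
  have h3 : act (∑ i : Fin l ↪ Fin n, pairing i) = ∑ i : Fin l ↪ Fin n, act (pairing i) :=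
    map_sum (Matrix.toLpLinAlgEquiv 2) _ _
  rw [bodyOp_eq, act_smul, LinearMap.smul_apply, h3, LinearMap.sum_apply,
    Finset.sum_congr rfl fun i _ => h1 i, Finset.sum_const, Finset.card_univ,
    Fintype.card_embedding_eq, Fintype.card_fin, Fintype.card_fin, ← Nat.cast_smul_eq_nsmul ℂ] at h2
  have h4 : (n.descFactorial l : ℂ) ≠ 0 := by
    have : n.descFactorial l ≠ 0 := by
      rw [Ne, Nat.descFactorial_eq_zero_iff_lt]
      omega
    exact_mod_cast this
  have h5 : ((l / 2).factorial : ℂ) ≠ 0 := by exact_mod_cast (l / 2).factorial_ne_zero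
  simp [h4, h5] at h2

theorem trace_bodyOp_sq_ne_zero {l : ℕ} (hl : l ≤ n) :
    (bodyOp n l * bodyOp n l).trace.re ≠ 0 := by
  open scoped ComplexOrder in
  intro h
  have hH := bodyOp_isHermitian (n := n) l
  have hHH : (bodyOp n l * bodyOp n l).IsHermitian := by
    rw [Matrix.IsHermitian, Matrix.conjTranspose_mul, hH.eq]
  have h1 : ((bodyOp n l).conjTranspose * bodyOp n l).trace = 0 := by
    rw [hH.eq, isHermitian_trace_eq hHH, h, Complex.ofReal_zero]
  exact bodyOp_ne_zero hl (Matrix.trace_conjTranspose_mul_self_eq_zero_iff.1 h1)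

/-- The one-parameter group generated by `C_l`. -/
noncomputable def bodyFlow (n l : ℕ) (t : ℝ) : symUnitary n :=
  ⟨⟨expI ((t : ℂ) • bodyOp n l), expI_mem_unitaryGroup (by
    rw [Matrix.IsHermitian, Matrix.conjTranspose_smul, (bodyOp_isHermitian l).eq, Complex.star_def,
      Complex.conj_ofReal])⟩, fun U hU =>
    (commute_expI (((bodyOp_isRotInvariant l) U hU).symm.smul_right _)).symm⟩

theorem coe_bodyFlow (l : ℕ) (t : ℝ) :
    ((bodyFlow n l t).1 : Op n) = expI ((t : ℂ) • bodyOp n l) := rfl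

theorem continuous_expI {ι : Type*} [Fintype ι] [DecidableEq ι] :
    Continuous (expI : Matrix ι ι ℂ → Matrix ι ι ℂ) := by
  open scoped Matrix.Norms.L2Operator in
  let +nondep : NormedAlgebra ℚ (Matrix ι ι ℂ) := NormedAlgebra.restrictScalars ℚ ℂ (Matrix ι ι ℂ)
  exact NormedSpace.exp_continuous.comp (continuous_const_smul Complex.I)

theorem continuous_bodyFlow (l : ℕ) : Continuous (bodyFlow n l) := by
  refine Continuous.subtype_mk (Continuous.subtype_mk ?_ _) _
  exact continuous_expI.comp (Complex.continuous_ofReal.smul continuous_const)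

theorem bodyFlow_zero (l : ℕ) : bodyFlow n l 0 = 1 := by
  refine Subtype.ext (Subtype.ext ?_)
  rw [coe_bodyFlow, Complex.ofReal_zero, zero_smul, expI_zero]
  rfl

theorem bodyPhase_bodyFlow (l : ℕ) (t : ℝ) : bodyPhase l ((bodyFlow n l t).1 : Op n)
    = ((t * (bodyOp n l * bodyOp n l).trace.re : ℝ) : Real.Angle) := by
  rw [coe_bodyFlow, bodyPhase_expI l, mul_smul_comm, Matrix.trace_smul, smul_eq_mul,
    Complex.re_ofReal_mul]
  · rw [Matrix.IsHermitian, Matrix.conjTranspose_smul, (bodyOp_isHermitian l).eq, Complex.star_def,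
      Complex.conj_ofReal]
  · exact (commute_angMomSq (commute_bodyOp_total l)).smul_left _

theorem continuous_extendByOne : Continuous (extendByOne : Op n → Op (n + 1)) := by
  refine continuous_matrix fun x y => ?_
  exact (continuous_id.matrix_elem _ _).mul continuous_const

/-- The map V ↦ Φ_l(V ⊗ I) is a character whose rate along the flow of `C_l` is 2 Tr(C_l²). -/
theorem isGeneric_bodyPhase_ne_zero {l : ℕ} (hl : Even l) (hln : l ≤ n) :
    IsGeneric {V : symUnitary n | bodyPhase l (extendByOne (V.1 : Op n)) ≠ 0} := by
  refine isGeneric_ne_zero (γ := bodyFlow n l) (a := 2 * (bodyOp n l * bodyOp n l).trace.re)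
    ?_ ?_ (continuous_bodyFlow l) (bodyFlow_zero l)
    (mul_ne_zero two_ne_zero (trace_bodyOp_sq_ne_zero hln)) ?_
  · exact continuous_bodyPhase l (continuous_extendByOne.comp
      (continuous_subtype_val.comp continuous_subtype_val))
      fun V => isSymm_extendByOne (isSymm_of_mem V.2)
  · intro V W
    rw [bodyPhase_extendByOne hl (isSymm_of_mem (V * W).2),
      bodyPhase_extendByOne hl (isSymm_of_mem V.2),
      bodyPhase_extendByOne hl (isSymm_of_mem W.2), ← smul_add,
      ← bodyPhase_mul l (isSymm_of_mem V.2) (isSymm_of_mem W.2)]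
    rfl
  · intro t
    rw [bodyPhase_extendByOne hl (isSymm_of_mem (bodyFlow n l t).2), bodyPhase_bodyFlow,
      ← Real.Angle.coe_nsmul, nsmul_eq_mul]
    congr 1
    push_cast
    ring

theorem not_mem_localSymUnitary {k l : ℕ} (hl : Even l) (hkl : k < l) {V : Op n}
    (hV : bodyPhase l (extendByOne V) ≠ 0) :
    ¬ ∃ W ∈ localSymUnitary (n + 1) k, (W : Op (n + 1)) = extendByOne V := by
  rintro ⟨W, hW, hWV⟩
  rw [← hWV] at hV
  exact hV (bodyPhase_eq_zero_of_mem_localSymUnitary hl hkl hW)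

theorem not_implementableWithAncilla {k l : ℕ} (hl : Even l) (hl2 : 2 ≤ l) (hkl : k < l)
    {V : Matrix.unitaryGroup (Bits n) ℂ} (hV : V ∈ symUnitary n)
    (hne : bodyPhase l (extendByOne (V : Op n)) ≠ 0) :
    ¬ ImplementableWithAncilla k (V : Op n) := by
  rintro ⟨W, hW, η, hη, himp⟩
  refine hne ?_
  rw [bodyPhase_extendByOne hl (isSymm_of_mem hV),
    ← himp.bodyPhase_eq hV (localSymUnitary_le _ _ hW) hη hl hl2]
  exact bodyPhase_eq_zero_of_mem_localSymUnitary hl hkl hW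

theorem isGeneric_not_implementable (n : ℕ) : IsGeneric {V : symUnitary n |
    (∀ l : ℕ, Even l → l ≤ 2 * (n / 2) → bodyPhase l (extendByOne (V.1 : Op n)) ≠ 0) ∧
    ∀ k : ℕ, k < 2 * (n / 2) →
      (¬ ∃ W ∈ localSymUnitary (n + 1) k, (W : Op (n + 1)) = extendByOne (V.1 : Op n)) ∧
      ¬ ImplementableWithAncilla k (V.1 : Op n)} := by
  have h := isGeneric_biInter ((Finset.range (2 * (n / 2) + 1)).filter Even)
    (S := fun l => {V : symUnitary n | bodyPhase l (extendByOne (V.1 : Op n)) ≠ 0}) (by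
      intro l hl
      rw [Finset.mem_filter, Finset.mem_range] at hl
      exact isGeneric_bodyPhase_ne_zero hl.2 (by omega))
  convert h using 1
  ext V
  simp only [Set.mem_ofPred_eq, Finset.mem_filter, Finset.mem_range]
  constructor
  · exact fun hV l hl => hV.1 l hl.2 (by omega)
  · intro hV
    refine ⟨fun l hl hln => hV l ⟨by omega, hl⟩, fun k hk => ?_⟩
    -- The top phase l = 2⌊n/2⌋ settles all smaller k at once; the existence of k < l forces l ≥ 2,
    -- so global phases do not matter.
    have hne := hV (2 * (n / 2)) ⟨by omega, even_two_mul _⟩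
    exact ⟨not_mem_localSymUnitary (even_two_mul _) hk hne,
      not_implementableWithAncilla (even_two_mul _) (by omega) hk V.2 hne⟩

end SpinQubit

theorem mainTheorem5 (n : ℕ) :
    -- a unitary implementing `V` with one ancilla equals `V ⊗ I_a`, up to a global phase
    (∀ V ∈ symUnitary n, ∀ W ∈ symUnitary (n + 1), ∀ η : EuclideanSpace ℂ (Fin 2), ‖η‖ = 1 →
      Implements (W : Op (n + 1)) (V : Op n) η →
      ∃ c : ℂ, ‖c‖ = 1 ∧
        (∀ ψ : Hilb n, act (W : Op (n + 1)) (withAncilla ψ η)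
          = withAncilla (act (V : Op n) ψ) (c • η)) ∧
        (W : Op (n + 1)) = c • extendByOne (V : Op n) ∧
        ∀ l : ℕ, Even l → 2 ≤ l →
          bodyPhase l (W : Op (n + 1)) = (2 : ℕ) • bodyPhase l (V : Op n)) ∧
    -- with the phase absorbed, so that the ancilla returns to its initial state
    (∀ V ∈ symUnitary n, ∀ W ∈ symUnitary (n + 1), ∀ η : EuclideanSpace ℂ (Fin 2), ‖η‖ = 1 →
      (∀ ψ : Hilb n, ‖ψ‖ = 1 → act (W : Op (n + 1)) (withAncilla ψ η)
        = withAncilla (act (V : Op n) ψ) η) →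
      (W : Op (n + 1)) = extendByOne (V : Op n) ∧
        ∀ l : ℕ, Even l → bodyPhase l (W : Op (n + 1)) = (2 : ℕ) • bodyPhase l (V : Op n)) ∧
    -- generic symmetric unitaries cannot be implemented
    IsGeneric {V : symUnitary n |
      (∀ l : ℕ, Even l → l ≤ 2 * (n / 2) → bodyPhase l (extendByOne (V.1 : Op n)) ≠ 0) ∧
      ∀ k : ℕ, k < 2 * (n / 2) →
        (¬ ∃ W ∈ localSymUnitary (n + 1) k, (W : Op (n + 1)) = extendByOne (V.1 : Op n)) ∧
        ¬ ImplementableWithAncilla k (V.1 : Op n)} ∧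
    -- hence one ancilla does not give universality
    (∀ k : ℕ, k < 2 * (n / 2) →
      ∃ V ∈ symUnitary n, ¬ ImplementableWithAncilla k (V : Op n)) := by
  refine ⟨fun V hV W hW η hη h => ?_, fun V hV W hW η hη h => ?_, isGeneric_not_implementable n,
    fun k hk => ?_⟩
  · obtain ⟨c, hc, h1, h2⟩ := h.exists_phase hV hW hη
    exact ⟨c, hc, h1, h2, fun l hl hl2 => h.bodyPhase_eq hV hW hη hl hl2⟩
  · have h1 := eq_extendByOne_of_forall hV hW hη h
    exact ⟨h1, fun l hl => by rw [h1, bodyPhase_extendByOne hl (isSymm_of_mem hV)]⟩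
  · obtain ⟨V, hV⟩ := (isGeneric_not_implementable n).2.1.nonempty
    exact ⟨V.1, V.2, (hV.2 k hk).2⟩
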